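/- Let $R$ be a commutative ring, $A$ an associative unital $R$-algebra and $(C,\Delta,\varepsilon)$ a coassociative counital $R$-coalgebra; $\otimes=\otimes_R$. A \emph{right-right entwining structure} $(A,C,\psi)$ is given by an $R$-linear map $\psi:C\otimes A\to A\otimes C$, $c\otimes a\mapsto\sum a_\psi\otimes c^\psi$, with $$\sum (ab)_\psi\otimes c^\psi=\sum a_\psi b_\Psi\otimes c^{\psi\Psi},\quad \sum 1_\psi\otimes c^\psi=1\otimes c,\quad \sum a_\psi\otimes\Delta(c^\psi)=\sum a_{\psi\Psi}\otimes c_1^{\Psi}\otimes c_2^{\psi},\quad \sum a_\psi\varepsilon(c^\psi)=\varepsilon(c)a .$$ An \emph{entwined module} is a right $A$-module $M$ that is also a (coassociative, counital) right $C$-comodule by $\varrho_M:M\to M\otimes C$, $m\mapsto\sum m_{<0>}\otimes m_{<1>}$, with $\varrho_M(ma)=\sum m_{<0>}a_\psi\otimes m_{<1>}^\psi$; $\mathcal M_A^C(\psi)$ is the category of entwined modules and $A$-linear $C$-colinear maps. Let $\#:=\#^{op}_\psi(C,A)$ be the ring $\mathrm{Hom}_R(C,A)$ with product $(f\cdot g)(c)=\sum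 f(c_2)_\psi\, g(c_1^\psi)$ and unit $c\mapsto\varepsilon(c)1_A$, and $\mathcal M_\#$ its category of right modules; a right $\#$-module is an $A$-module through the ring map $A\to\#$, $a\mapsto\varepsilon(-)a$. Every entwined module is a right $\#$-module by $mf=\sum m_{<0>}f(m_{<1>})$; this gives a functor $\Phi:\mathcal M_A^C(\psi)\to\mathcal M_\#$ which is the identity on underlying groups and on maps. The module $A\otimes C$ is entwined by $(\tilde a\otimes c)a=\sum\tilde a a_\psi\otimes c^\psi$ and $\mathrm{id}_A\otimes\Delta$, hence is a right $\#$-module. For a right $\#$-module $M$ let $\mathrm{Rat}^C(M)$ be the set of all $m\in M$ for which there is $\sum m_i\otimes c_i\in M\otimes C$ with $mf=\sum m_if(c_i)$ for all $f\in\#$; $\mathrm{Rat}^C(\mathcal M_\#)$ is the full subcategory of $\mathcal M_\#$ of the modules with $\mathrm{Rat}^C(M)=M$. For a right $\#$-module $K$, $\sigma[K_\#]$ is the full subcategory of $\mathcal M_\#$ of the modules isomorphic to a submodule of a quotient of a direct sum of copies of $K$. An $R$-module $W$ is \emph{locally projective} if for every surjective $\pi:L\to N$, every $g:W\to N$ and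 every finitely generated submodule $F\subseteq W$ there is $g':W\to L$ with $\pi g'|_F=g|_F$. \textbf{Theorem.} Let $(A,C,\psi)$ be a right-right entwining structure over $R$. (1) If $C$ is flat over $R$, then $\mathcal M_A^C(\psi)$ is a Grothendieck category with enough injective objects. (2) If $C$ is locally projective over $R$, then for every right $A$-module $M$ the map $M\otimes C\to\mathrm{Hom}_R(\#,M)$, $m\otimes c\mapsto[f\mapsto mf(c)]$, is injective (the $\alpha$-condition, so that the elements $\sum m_i\otimes c_i$ above are unique), and $\Phi$ induces isomorphisms of categories $$\mathcal M_A^C(\psi)\simeq \mathrm{Rat}^C(\mathcal M_{\#^{op}_\psi(C,A)})=\sigma[(A\otimes C)_{\#^{op}_\psi(C,A)}].$$ (3) If $C$ is finitely generated and projective over $R$, then $\Phi:\mathcal M_A^C(\psi)\to\mathcal M_{\#^{op}_\psi(C,A)}$ is an isomorphism of categories. -/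

import Mathlib

open scoped TensorProduct
open CategoryTheory MulOpposite

universe u v w v' w'

set_option linter.unusedSectionVars false

noncomputable section

/-- Local projectivity: every linear map `g : W → N` can be lifted along every surjection
`p : L → N` after restriction to any finitely generated submodule `F` of `W`. -/
def IsLocallyProjective (R W : Type u) [CommRing R] [AddCommGroup W] [Module R W] : Prop :=
  ∀ (F : Submodule R W), F.FG →
    ∀ (L N : Type u) [AddCommGroup L] [Module R L] [AddCommGroup N] [Module R N]
      (p : L →ₗ[R] N) (g : W →ₗ[R] N), Function.Surjective p →
      ∃ g' : W →ₗ[R] L, ∀ x ∈ F, p (g' x) = g x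

/-- A functor is an isomorphism of categories: bijective on objects and on morphisms. -/
structure IsIsomorphismOfCategories {C : Type v} {D : Type w} [Category.{v'} C] [Category.{w'} D]
    (F : C ⥤ D) : Prop where
  full : F.Full
  faithful : F.Faithful
  bijective_obj : Function.Bijective F.obj

/-- The category `σ[K]` of `K`-subgenerated `S`-modules, as a property of `S`-modules: `N` is
isomorphic to a submodule of a module `P` that is a quotient of a direct sum of copies of `K`. -/
def IsSubgenerated {S : Type u} [Ring S] (K : ModuleCat.{u} S) :
    ObjectProperty (ModuleCat.{u} S) := fun N =>
  ∃ (I : Type u) (P : ModuleCat.{u} S) (q : (I →₀ K) →ₗ[S] P) (j : N →ₗ[S] P),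
    Function.Surjective q ∧ Function.Injective j

section Unbundled

variable {R A C : Type u} [CommRing R] [Ring A] [Algebra R A] [AddCommGroup C] [Module R C]

/-- The right action `m ↦ m a` of `A` on a right `A`-module (a left `Aᵐᵒᵖ`-module) `M`,
as the bilinear map `(m, a) ↦ m a`. -/
def rightMul (R A M : Type u) [CommRing R] [Ring A] [Algebra R A] [AddCommGroup M] [Module R M]
    [Module Aᵐᵒᵖ M] [IsScalarTower R Aᵐᵒᵖ M] : M →ₗ[R] A →ₗ[R] M :=
  LinearMap.mk₂ R (fun m a => op a • m)
    (fun m n a => smul_add _ _ _)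
    (fun r m a => smul_comm _ _ _)
    (fun m a b => by rw [MulOpposite.op_add, add_smul])
    (fun r m a => by rw [MulOpposite.op_smul, smul_assoc])

@[simp] theorem rightMul_apply (M : Type u) [AddCommGroup M] [Module R M]
    [Module Aᵐᵒᵖ M] [IsScalarTower R Aᵐᵒᵖ M] (m : M) (a : A) :
    rightMul R A M m a = op a • m := rfl

/-- For `f : C → A` the map `M ⊗ C → M`, `m ⊗ c ↦ m f(c)`. -/
def evalAt (M : Type u) [AddCommGroup M] [Module R M]
    [Module Aᵐᵒᵖ M] [IsScalarTower R Aᵐᵒᵖ M] (f : C →ₗ[R] A) : M ⊗[R] C →ₗ[R] M :=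
  TensorProduct.lift ((rightMul R A M).compl₂ f)

@[simp] theorem evalAt_tmul (M : Type u) [AddCommGroup M] [Module R M]
    [Module Aᵐᵒᵖ M] [IsScalarTower R Aᵐᵒᵖ M] (f : C →ₗ[R] A) (m : M) (c : C) :
    evalAt M f (m ⊗ₜ c) = op (f c) • m := rfl

end Unbundled

/-- A right-right entwining structure `(A, C, ψ)` over `R`. Below, `ψ (c ⊗ a) = ∑ a_ψ ⊗ c^ψ`. -/
structure EntwiningStructure (R A C : Type u) [CommRing R] [Ring A] [Algebra R A]
    [AddCommGroup C] [Module R C] [Coalgebra R C] where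
  /-- the entwining map `ψ : C ⊗ A → A ⊗ C` -/
  psi : C ⊗[R] A →ₗ[R] A ⊗[R] C
  /-- `∑ (a b)_ψ ⊗ c^ψ = ∑ a_ψ b_Ψ ⊗ c^{ψΨ}` -/
  psi_mul : ∀ (c : C) (a b : A),
    psi (c ⊗ₜ (a * b)) =
      (LinearMap.mul' R A).rTensor C ((TensorProduct.assoc R A A C).symm
        (psi.lTensor A (TensorProduct.assoc R A C A (psi (c ⊗ₜ a) ⊗ₜ b))))
  /-- `∑ 1_ψ ⊗ c^ψ = 1 ⊗ c` -/
  psi_one : ∀ c : C, psi (c ⊗ₜ 1) = 1 ⊗ₜ c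
  /-- `∑ a_ψ ⊗ Δ(c^ψ) = ∑ a_{ψΨ} ⊗ c₁^Ψ ⊗ c₂^ψ` -/
  psi_comul : ∀ (c : C) (a : A),
    (Coalgebra.comul (R := R) (A := C)).lTensor A (psi (c ⊗ₜ a)) =
      TensorProduct.assoc R A C C (psi.rTensor C ((TensorProduct.assoc R C A C).symm
        (psi.lTensor C (TensorProduct.assoc R C C A (Coalgebra.comul (R := R) c ⊗ₜ a)))))
  /-- `∑ a_ψ ε(c^ψ) = ε(c) a` -/
  psi_counit : ∀ (c : C) (a : A),
    TensorProduct.rid R A ((Coalgebra.counit (R := R) (A := C)).lTensor A (psi (c ⊗ₜ a))) =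
      Coalgebra.counit (R := R) c • a

namespace EntwiningStructure

variable {R A C : Type u} [CommRing R] [Ring A] [Algebra R A]
  [AddCommGroup C] [Module R C] [Coalgebra R C] (E : EntwiningStructure R A C)

section TwistedAction

variable (M : Type u) [AddCommGroup M] [Module R M] [Module Aᵐᵒᵖ M] [IsScalarTower R Aᵐᵒᵖ M]

/-- For a right `A`-module `M`, the map `(M ⊗ C) ⊗ A → M ⊗ C`,
`(m ⊗ c) ⊗ a ↦ ∑ m a_ψ ⊗ c^ψ`. -/
def twist : (M ⊗[R] C) ⊗[R] A →ₗ[R] M ⊗[R] C :=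
  (TensorProduct.lift (rightMul R A M)).rTensor C ∘ₗ
    (TensorProduct.assoc R M A C).symm.toLinearMap ∘ₗ
      E.psi.lTensor M ∘ₗ (TensorProduct.assoc R M C A).toLinearMap

end TwistedAction

/-- A (right-right) entwined module: a right `A`-module and a (coassociative, counital) right
`C`-comodule `M` over the same `R`-module structure, with
`ϱ(m a) = ∑ m₀ a_ψ ⊗ m₁^ψ`. -/
structure EntwinedModule where
  carrier : Type u
  [addCommGroup : AddCommGroup carrier]
  [module : Module R carrier]
  [moduleA : Module Aᵐᵒᵖ carrier]
  [isScalarTower : IsScalarTower R Aᵐᵒᵖ carrier]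
  /-- the coaction `ϱ : M → M ⊗ C` -/
  coact : carrier →ₗ[R] carrier ⊗[R] C
  coassoc : ∀ m : carrier,
    TensorProduct.assoc R carrier C C (coact.rTensor C (coact m)) =
      (Coalgebra.comul (R := R) (A := C)).lTensor carrier (coact m)
  counit : ∀ m : carrier,
    TensorProduct.rid R carrier
      ((Coalgebra.counit (R := R) (A := C)).lTensor carrier (coact m)) = m
  compat : ∀ (m : carrier) (a : A), coact (op a • m) = E.twist carrier (coact m ⊗ₜ a)

namespace EntwinedModule

attribute [instance] addCommGroup module moduleA isScalarTower

variable {E}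

/-- Morphisms of entwined modules: the `A`-linear and `C`-colinear maps. -/
@[ext] structure Hom (M N : E.EntwinedModule) where
  toLinearMap : M.carrier →ₗ[Aᵐᵒᵖ] N.carrier
  colinear : ∀ m : M.carrier,
    N.coact (toLinearMap m) = (toLinearMap.restrictScalars R).rTensor C (M.coact m)

/-- The category of entwined modules. -/
instance : Category.{u} E.EntwinedModule where
  Hom M N := Hom M N
  id M := ⟨LinearMap.id, fun m => by
    change M.coact m = LinearMap.rTensor C (LinearMap.id : M.carrier →ₗ[R] M.carrier) (M.coact m)
    simp⟩
  comp {M N P} f g := ⟨g.toLinearMap ∘ₗ f.toLinearMap, fun m => by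
    change P.coact (g.toLinearMap (f.toLinearMap m)) =
      LinearMap.rTensor C (g.toLinearMap.restrictScalars R ∘ₗ f.toLinearMap.restrictScalars R)
        (M.coact m)
    rw [g.colinear, f.colinear, LinearMap.rTensor_comp_apply]⟩
  id_comp f := Hom.ext (LinearMap.comp_id _)
  comp_id f := Hom.ext (LinearMap.id_comp _)
  assoc f g h := rfl

end EntwinedModule

section TwistedAction

variable (M : Type u) [AddCommGroup M] [Module R M] [Module Aᵐᵒᵖ M] [IsScalarTower R Aᵐᵒᵖ M]

theorem twist_tmul (m : M) (c : C) (a : A) :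
    E.twist M ((m ⊗ₜ c) ⊗ₜ a) = (rightMul R A M m).rTensor C (E.psi (c ⊗ₜ a)) := by
  simp only [twist, LinearMap.comp_apply, LinearEquiv.coe_coe, TensorProduct.assoc_tmul,
    LinearMap.lTensor_tmul]
  induction E.psi (c ⊗ₜ a) with
  | zero => simp
  | tmul b d => simp
  | add y z hy hz => simp only [TensorProduct.tmul_add, map_add, hy, hz]

theorem twist_one (x : M ⊗[R] C) : E.twist M (x ⊗ₜ 1) = x := by
  induction x with
  | zero => simp
  | tmul m c => rw [twist_tmul, E.psi_one]; simp
  | add y z hy hz => simp only [TensorProduct.add_tmul, map_add, hy, hz]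

theorem twist_mul (x : M ⊗[R] C) (a b : A) :
    E.twist M (x ⊗ₜ (a * b)) = E.twist M (E.twist M (x ⊗ₜ a) ⊗ₜ b) := by
  induction x with
  | zero => simp
  | add y z hy hz => simp only [TensorProduct.add_tmul, map_add, hy, hz]
  | tmul m c =>
    rw [twist_tmul, twist_tmul, E.psi_mul]
    induction E.psi (c ⊗ₜ a) with
    | zero => simp
    | add y z hy hz => simp only [TensorProduct.add_tmul, map_add, hy, hz]
    | tmul a' c' =>
      simp only [TensorProduct.assoc_tmul, LinearMap.lTensor_tmul, LinearMap.rTensor_tmul,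
        twist_tmul]
      induction E.psi (c' ⊗ₜ b) with
      | zero => simp
      | add y z hy hz => simp only [TensorProduct.tmul_add, map_add, hy, hz]
      | tmul a'' c'' => simp [mul_smul]

/-- The right `A`-action `(m ⊗ c) a = ∑ m a_ψ ⊗ c^ψ` on `M ⊗ C`. -/
@[reducible] def twistedModule : Module Aᵐᵒᵖ (M ⊗[R] C) where
  smul a x := E.twist M (x ⊗ₜ unop a)
  one_smul x := E.twist_one M x
  mul_smul a b x := E.twist_mul M x (unop b) (unop a)
  smul_zero a := by
    change E.twist M (0 ⊗ₜ unop a) = 0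
    rw [TensorProduct.zero_tmul, map_zero]
  smul_add a x y := by
    change E.twist M ((x + y) ⊗ₜ unop a) = E.twist M (x ⊗ₜ unop a) + E.twist M (y ⊗ₜ unop a)
    rw [← map_add, ← TensorProduct.add_tmul]
  add_smul a b x := by
    change E.twist M (x ⊗ₜ (unop a + unop b)) =
      E.twist M (x ⊗ₜ unop a) + E.twist M (x ⊗ₜ unop b)
    rw [← map_add, ← TensorProduct.tmul_add]
  zero_smul x := by
    change E.twist M (x ⊗ₜ 0) = 0
    rw [TensorProduct.tmul_zero, map_zero]

/-- For a right `A`-module `M`, the `R`-module `M ⊗ C` with the right `A`-action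
`(m ⊗ c) a = ∑ m a_ψ ⊗ c^ψ`. This is a type synonym: the plain tensor product already carries
a different action of `Aᵐᵒᵖ`. -/
def Cofree (_E : EntwiningStructure R A C) (M : Type u) [AddCommGroup M] [Module R M] : Type u :=
  M ⊗[R] C

instance : AddCommGroup (E.Cofree M) := inferInstanceAs (AddCommGroup (M ⊗[R] C))

instance : Module R (E.Cofree M) := inferInstanceAs (Module R (M ⊗[R] C))

/-- The identity `M ⊗ C → Cofree M`. -/
def toCofree : M ⊗[R] C ≃ₗ[R] E.Cofree M := LinearEquiv.refl R (M ⊗[R] C)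

instance : Module Aᵐᵒᵖ (E.Cofree M) := E.twistedModule M

theorem op_smul_toCofree (a : A) (x : M ⊗[R] C) :
    op a • E.toCofree M x = E.toCofree M (E.twist M (x ⊗ₜ a)) := rfl

instance : IsScalarTower R Aᵐᵒᵖ (E.Cofree M) where
  smul_assoc r a x := by
    obtain ⟨x, rfl⟩ := (E.toCofree M).surjective x
    obtain ⟨a, rfl⟩ := MulOpposite.op_surjective a
    rw [← MulOpposite.op_smul, op_smul_toCofree, op_smul_toCofree, TensorProduct.tmul_smul,
      map_smul, map_smul]

/-- The coaction `m ⊗ c ↦ ∑ (m ⊗ c₁) ⊗ c₂` on `M ⊗ C`. -/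
def cofreeCoact : E.Cofree M →ₗ[R] E.Cofree M ⊗[R] C :=
  (E.toCofree M).toLinearMap.rTensor C ∘ₗ (TensorProduct.assoc R M C C).symm.toLinearMap ∘ₗ
    (Coalgebra.comul (R := R) (A := C)).lTensor M ∘ₗ (E.toCofree M).symm.toLinearMap

theorem cofreeCoact_toCofree (x : M ⊗[R] C) :
    E.cofreeCoact M (E.toCofree M x) =
      (E.toCofree M).toLinearMap.rTensor C ((TensorProduct.assoc R M C C).symm
        ((Coalgebra.comul (R := R) (A := C)).lTensor M x)) := by
  simp [cofreeCoact]

theorem cofreeCoact_coassoc (x : E.Cofree M) :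
    TensorProduct.assoc R (E.Cofree M) C C
      ((E.cofreeCoact M).rTensor C (E.cofreeCoact M x)) =
      (Coalgebra.comul (R := R) (A := C)).lTensor (E.Cofree M) (E.cofreeCoact M x) := by
  obtain ⟨x, rfl⟩ := (E.toCofree M).surjective x
  induction x with
  | zero => simp
  | add y z hy hz => simp only [map_add, hy, hz]
  | tmul m c =>
    let j : C →ₗ[R] E.Cofree M := (E.toCofree M).toLinearMap ∘ₗ TensorProduct.mk R M C m
    have key (c : C) : E.cofreeCoact M (j c) = j.rTensor C (Coalgebra.comul (R := R) c) := by
      change E.cofreeCoact M (E.toCofree M (m ⊗ₜ c)) = _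
      rw [cofreeCoact_toCofree, LinearMap.lTensor_tmul]
      induction Coalgebra.comul (R := R) c with
      | zero => simp
      | add y z hy hz => simp only [TensorProduct.tmul_add, map_add, hy, hz]
      | tmul a b => simp [j]
    have key2 : E.cofreeCoact M ∘ₗ j = j.rTensor C ∘ₗ Coalgebra.comul (R := R) :=
      LinearMap.ext key
    change TensorProduct.assoc R (E.Cofree M) C C
      ((E.cofreeCoact M).rTensor C (E.cofreeCoact M (j c))) =
      (Coalgebra.comul (R := R) (A := C)).lTensor (E.Cofree M) (E.cofreeCoact M (j c))
    rw [key, ← LinearMap.rTensor_comp_apply, key2, LinearMap.rTensor_comp_apply]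
    have h := Coalgebra.coassoc_apply (R := R) c
    have hL (z : (C ⊗[R] C) ⊗[R] C) :
        TensorProduct.assoc R (E.Cofree M) C C ((j.rTensor C).rTensor C z) =
          j.rTensor (C ⊗[R] C) (TensorProduct.assoc R C C C z) := by
      induction z with
      | zero => simp
      | add y z hy hz => simp only [map_add, hy, hz]
      | tmul w b =>
        induction w with
        | zero => simp
        | add y z hy hz => simp only [TensorProduct.add_tmul, map_add, hy, hz]
        | tmul a b => simp
    rw [hL, h]
    exact LinearMap.congr_fun
      ((LinearMap.rTensor_comp_lTensor _ _ _).trans (LinearMap.lTensor_comp_rTensor _ _ _).symm) _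

theorem cofreeCoact_counit (x : E.Cofree M) :
    TensorProduct.rid R (E.Cofree M)
      ((Coalgebra.counit (R := R) (A := C)).lTensor (E.Cofree M) (E.cofreeCoact M x)) = x := by
  obtain ⟨x, rfl⟩ := (E.toCofree M).surjective x
  induction x with
  | zero => simp
  | add y z hy hz => simp only [map_add, hy, hz]
  | tmul m c =>
    rw [cofreeCoact_toCofree, LinearMap.lTensor_tmul]
    have h := congrArg (TensorProduct.rid R C) (Coalgebra.lTensor_counit_comul (R := R) c)
    rw [TensorProduct.rid_tmul, one_smul] at h
    have h2 (z : C ⊗[R] C) : TensorProduct.rid R (E.Cofree M)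
        ((Coalgebra.counit (R := R) (A := C)).lTensor (E.Cofree M)
          ((E.toCofree M).toLinearMap.rTensor C ((TensorProduct.assoc R M C C).symm (m ⊗ₜ z)))) =
        E.toCofree M (m ⊗ₜ TensorProduct.rid R C
          ((Coalgebra.counit (R := R) (A := C)).lTensor C z)) := by
      induction z with
      | zero => simp
      | add y z hy hz => simp only [TensorProduct.tmul_add, map_add, hy, hz]
      | tmul a b => simp
    rw [h2, h]

theorem cofreeCoact_compat (x : E.Cofree M) (a : A) :
    E.cofreeCoact M (op a • x) = E.twist (E.Cofree M) (E.cofreeCoact M x ⊗ₜ a) := by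
  obtain ⟨x, rfl⟩ := (E.toCofree M).surjective x
  rw [op_smul_toCofree, cofreeCoact_toCofree, cofreeCoact_toCofree]
  induction x with
  | zero => simp
  | add y z hy hz => simp only [TensorProduct.add_tmul, map_add, hy, hz]
  | tmul m c =>
    rw [twist_tmul, ← LinearMap.comp_apply (LinearMap.lTensor _ _), LinearMap.lTensor_comp_rTensor,
      ← LinearMap.rTensor_comp_lTensor, LinearMap.comp_apply, E.psi_comul,
      LinearMap.lTensor_tmul]
    induction Coalgebra.comul (R := R) c with
    | zero => simp
    | add y z hy hz => simp only [TensorProduct.tmul_add, TensorProduct.add_tmul, map_add, hy, hz]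
    | tmul c₁ c₂ =>
      simp only [TensorProduct.assoc_tmul, LinearMap.lTensor_tmul, TensorProduct.assoc_symm_tmul,
        LinearMap.rTensor_tmul, twist_tmul, LinearEquiv.coe_coe]
      induction E.psi (c₂ ⊗ₜ a) with
      | zero => simp
      | add y z hy hz => simp only [TensorProduct.tmul_add, map_add, hy, hz]
      | tmul a' c' =>
        simp only [TensorProduct.assoc_symm_tmul, LinearMap.rTensor_tmul, rightMul_apply,
          op_smul_toCofree, twist_tmul]
        induction E.psi (c₁ ⊗ₜ a') with
        | zero => simp
        | add y z hy hz => simp only [TensorProduct.add_tmul, map_add, hy, hz]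
        | tmul a'' c'' => simp

/-- `M ⊗ C` as an entwined module. -/
def cofree : E.EntwinedModule where
  carrier := E.Cofree M
  coact := E.cofreeCoact M
  coassoc := E.cofreeCoact_coassoc M
  counit := E.cofreeCoact_counit M
  compat := E.cofreeCoact_compat M

end TwistedAction

section Sharp

/-- `∑ f(c₂)_ψ ⊗ c₁^ψ`, as a function of `c`. -/
def sharpTwist (f : C →ₗ[R] A) : C →ₗ[R] A ⊗[R] C :=
  E.psi ∘ₗ f.lTensor C ∘ₗ Coalgebra.comul (R := R)

/-- The product `(f · g)(c) = ∑ f(c₂)_ψ g(c₁^ψ)`. -/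
def sharpMul (f g : C →ₗ[R] A) : C →ₗ[R] A := evalAt A g ∘ₗ E.sharpTwist f

/-- The map `c ↦ ε(c) a`. -/
def sharpConst (a : A) : C →ₗ[R] A := (Coalgebra.counit (R := R) (A := C)).smulRight a

theorem evalAt_sharpConst (M : Type u) [AddCommGroup M] [Module R M] [Module Aᵐᵒᵖ M]
    [IsScalarTower R Aᵐᵒᵖ M] (a : A) (x : M ⊗[R] C) :
    evalAt M (sharpConst a) x = op a • TensorProduct.rid R M
      ((Coalgebra.counit (R := R) (A := C)).lTensor M x) := by
  induction x with
  | zero => simp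
  | add y z hy hz => simp only [map_add, hy, hz, smul_add]
  | tmul m c =>
    rw [evalAt_tmul, LinearMap.lTensor_tmul, TensorProduct.rid_tmul, sharpConst,
      LinearMap.smulRight_apply, MulOpposite.op_smul, smul_assoc, smul_comm]

theorem counit_sharpTwist (f : C →ₗ[R] A) (c : C) :
    TensorProduct.rid R A ((Coalgebra.counit (R := R) (A := C)).lTensor A
      (E.sharpTwist f c)) = f c := by
  have h := congrArg (TensorProduct.lid R C) (Coalgebra.rTensor_counit_comul (R := R) c)
  rw [TensorProduct.lid_tmul, one_smul] at h
  have h2 (z : C ⊗[R] C) : TensorProduct.rid R A ((Coalgebra.counit (R := R) (A := C)).lTensor A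
      (E.psi (f.lTensor C z))) =
      f (TensorProduct.lid R C ((Coalgebra.counit (R := R) (A := C)).rTensor C z)) := by
    induction z with
    | zero => simp
    | add y z hy hz => simp only [map_add, hy, hz]
    | tmul a b => rw [LinearMap.lTensor_tmul, E.psi_counit]; simp
  change TensorProduct.rid R A ((Coalgebra.counit (R := R) (A := C)).lTensor A
      (E.psi (f.lTensor C (Coalgebra.comul (R := R) c)))) = f c
  rw [h2, h]

variable {E} in
/-- The right action `m f = ∑ m₀ f(m₁)` of a linear map `f : C → A` on an entwined module. -/
def EntwinedModule.act (M : E.EntwinedModule) (f : C →ₗ[R] A) : M.carrier →ₗ[R] M.carrier :=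
  evalAt M.carrier f ∘ₗ M.coact

theorem EntwinedModule.coact_act (M : E.EntwinedModule) (f : C →ₗ[R] A) (m : M.carrier) :
    M.coact (M.act f m) =
      (TensorProduct.lift (rightMul R A M.carrier)).rTensor C
        ((TensorProduct.assoc R M.carrier A C).symm
          ((E.sharpTwist f).lTensor M.carrier (M.coact m))) := by
  have h1 (x : M.carrier ⊗[R] C) : M.coact (evalAt M.carrier f x) =
      E.twist M.carrier (f.lTensor _ (M.coact.rTensor C x)) := by
    induction x with
    | zero => simp
    | add y z hy hz => simp only [map_add, hy, hz]
    | tmul n c => simp [M.compat]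
  have h2 : M.coact.rTensor C (M.coact m) = (TensorProduct.assoc R M.carrier C C).symm
      ((Coalgebra.comul (R := R) (A := C)).lTensor M.carrier (M.coact m)) := by
    rw [LinearEquiv.eq_symm_apply, M.coassoc]
  change M.coact (evalAt M.carrier f (M.coact m)) = _
  rw [h1, h2]
  induction M.coact m with
  | zero => simp
  | add y z hy hz => simp only [map_add, hy, hz]
  | tmul n c =>
    simp only [LinearMap.lTensor_tmul, sharpTwist, LinearMap.comp_apply]
    induction Coalgebra.comul (R := R) c with
    | zero => simp
    | add y z hy hz => simp only [TensorProduct.tmul_add, map_add, hy, hz]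
    | tmul a b =>
      rw [TensorProduct.assoc_symm_tmul, LinearMap.lTensor_tmul, LinearMap.lTensor_tmul,
        twist_tmul]
      induction E.psi (a ⊗ₜ f b) with
      | zero => simp
      | add y z hy hz => simp only [TensorProduct.tmul_add, map_add, hy, hz]
      | tmul a' c' => simp

theorem EntwinedModule.act_act (M : E.EntwinedModule) (f g : C →ₗ[R] A) (m : M.carrier) :
    M.act g (M.act f m) = M.act (E.sharpMul f g) m := by
  change evalAt M.carrier g (M.coact (M.act f m)) = evalAt M.carrier _ (M.coact m)
  rw [M.coact_act]
  induction M.coact m with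
  | zero => simp
  | add y z hy hz => simp only [map_add, hy, hz]
  | tmul n c =>
    simp only [LinearMap.lTensor_tmul, evalAt_tmul, sharpMul, LinearMap.comp_apply]
    induction E.sharpTwist f c with
    | zero => simp
    | add y z hy hz => simp only [TensorProduct.tmul_add, map_add, MulOpposite.op_add, add_smul,
        hy, hz]
    | tmul a' c' => simp [mul_smul]

theorem EntwinedModule.act_const (M : E.EntwinedModule) (a : A) (m : M.carrier) :
    M.act (sharpConst a) m = op a • m := by
  change evalAt M.carrier (sharpConst a) (M.coact m) = _
  rw [evalAt_sharpConst, M.counit]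

theorem EntwinedModule.act_one (M : E.EntwinedModule) (m : M.carrier) :
    M.act (sharpConst 1) m = m := by
  rw [EntwinedModule.act_const, MulOpposite.op_one, one_smul]

/-- The counit `a ⊗ c ↦ a ε(c)` of `A ⊗ C`. -/
def cofreeCounit : E.Cofree A →ₗ[R] A :=
  (TensorProduct.rid R A).toLinearMap ∘ₗ (Coalgebra.counit (R := R) (A := C)).lTensor A ∘ₗ
    (E.toCofree A).symm.toLinearMap

/-- The right action of a linear map `f : C → A` on `A ⊗ C`. -/
def cofreeAct (f : C →ₗ[R] A) : E.Cofree A →ₗ[R] E.Cofree A := (E.cofree A).act f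

theorem cofreeAct_cofreeAct (f g : C →ₗ[R] A) (x : E.Cofree A) :
    E.cofreeAct g (E.cofreeAct f x) = E.cofreeAct (E.sharpMul f g) x :=
  EntwinedModule.act_act E (E.cofree A) f g x

theorem cofreeAct_one (x : E.Cofree A) : E.cofreeAct (sharpConst 1) x = x :=
  EntwinedModule.act_one E (E.cofree A) x

theorem cofreeAct_one_tmul (f : C →ₗ[R] A) (c : C) :
    E.cofreeAct f (E.toCofree A (1 ⊗ₜ c)) = E.toCofree A (E.sharpTwist f c) := by
  change evalAt (E.Cofree A) f (E.cofreeCoact A (E.toCofree A (1 ⊗ₜ c))) = _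
  rw [cofreeCoact_toCofree, LinearMap.lTensor_tmul]
  simp only [sharpTwist, LinearMap.comp_apply]
  induction Coalgebra.comul (R := R) c with
  | zero => simp
  | add y z hy hz => simp only [TensorProduct.tmul_add, map_add, hy, hz]
  | tmul a b =>
    rw [TensorProduct.assoc_symm_tmul, LinearMap.rTensor_tmul, evalAt_tmul, LinearEquiv.coe_coe,
      op_smul_toCofree, twist_tmul, LinearMap.lTensor_tmul]
    congr 1
    induction E.psi (a ⊗ₜ f b) with
    | zero => simp
    | add y z hy hz => simp only [map_add, hy, hz]
    | tmul a' c' => simp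

theorem cofreeCounit_cofreeAct (f : C →ₗ[R] A) (x : A ⊗[R] C) :
    E.cofreeCounit (E.cofreeAct f (E.toCofree A x)) = evalAt A f x := by
  induction x with
  | zero => simp
  | add y z hy hz => simp only [map_add, hy, hz]
  | tmul a c =>
    have h1 : evalAt A f (a ⊗ₜ c) = a * TensorProduct.rid R A
        ((Coalgebra.counit (R := R) (A := C)).lTensor A (E.sharpTwist f c)) := by
      rw [counit_sharpTwist]; simp
    have h2 : E.cofreeAct f (E.toCofree A (a ⊗ₜ c)) =
        E.toCofree A ((LinearMap.mulLeft R a).rTensor C (E.sharpTwist f c)) := by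
      change evalAt (E.Cofree A) f (E.cofreeCoact A (E.toCofree A (a ⊗ₜ c))) = _
      rw [cofreeCoact_toCofree, LinearMap.lTensor_tmul]
      simp only [sharpTwist, LinearMap.comp_apply]
      induction Coalgebra.comul (R := R) c with
      | zero => simp
      | add y z hy hz => simp only [TensorProduct.tmul_add, map_add, hy, hz]
      | tmul d b =>
        rw [TensorProduct.assoc_symm_tmul, LinearMap.rTensor_tmul, evalAt_tmul,
          LinearEquiv.coe_coe, op_smul_toCofree, twist_tmul, LinearMap.lTensor_tmul]
        rfl
    rw [h1, h2]
    change TensorProduct.rid R A ((Coalgebra.counit (R := R) (A := C)).lTensor A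
      ((LinearMap.mulLeft R a).rTensor C (E.sharpTwist f c))) = _
    induction E.sharpTwist f c with
    | zero => simp
    | add y z hy hz => simp only [map_add, hy, hz, mul_add]
    | tmul a' c' => simp

theorem sharpMul_const (f : C →ₗ[R] A) (a : A) (c : C) :
    E.sharpMul f (sharpConst a) c = f c * a := by
  change evalAt A (sharpConst a) (E.sharpTwist f c) = _
  rw [evalAt_sharpConst, counit_sharpTwist]; rfl

theorem sharpMul_one (f : C →ₗ[R] A) : E.sharpMul f (sharpConst 1) = f := by
  ext c; rw [sharpMul_const, mul_one]

theorem sharpMul_eq (f g : C →ₗ[R] A) (c : C) :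
    E.sharpMul f g c =
      E.cofreeCounit (E.cofreeAct g (E.cofreeAct f (E.toCofree A (1 ⊗ₜ c)))) := by
  rw [cofreeAct_one_tmul, cofreeCounit_cofreeAct]; rfl

theorem one_sharpMul (f : C →ₗ[R] A) : E.sharpMul (sharpConst 1) f = f := by
  ext c
  rw [sharpMul_eq, cofreeAct_one, cofreeCounit_cofreeAct]
  simp

theorem sharpMul_assoc (f g h : C →ₗ[R] A) :
    E.sharpMul (E.sharpMul f g) h = E.sharpMul f (E.sharpMul g h) := by
  ext c
  rw [sharpMul_eq, sharpMul_eq, ← cofreeAct_cofreeAct, ← cofreeAct_cofreeAct]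

/-- The ring `#^op_ψ(C, A)`: the group `Hom_R(C, A)` with the product
`(f · g)(c) = ∑ f(c₂)_ψ g(c₁^ψ)` and unit `c ↦ ε(c) 1`. -/
def Sharp (_E : EntwiningStructure R A C) : Type u := C →ₗ[R] A

instance : AddCommGroup E.Sharp := inferInstanceAs (AddCommGroup (C →ₗ[R] A))

/-- The identity `Hom_R(C, A) → #^op_ψ(C, A)`. -/
def toSharp : (C →ₗ[R] A) ≃+ E.Sharp := AddEquiv.refl (C →ₗ[R] A)

/-- The linear map underlying an element of `#^op_ψ(C, A)`. -/
def ofSharp : E.Sharp ≃+ (C →ₗ[R] A) := AddEquiv.refl (C →ₗ[R] A)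

theorem evalAt_add (M : Type u) [AddCommGroup M] [Module R M] [Module Aᵐᵒᵖ M]
    [IsScalarTower R Aᵐᵒᵖ M] (f g : C →ₗ[R] A) (x : M ⊗[R] C) :
    evalAt M (f + g) x = evalAt M f x + evalAt M g x := by
  induction x with
  | zero => simp
  | add y z hy hz => rw [map_add, map_add, map_add, hy, hz]; abel
  | tmul m c => simp [add_smul]

theorem add_sharpMul (f g h : C →ₗ[R] A) :
    E.sharpMul (f + g) h = E.sharpMul f h + E.sharpMul g h := by
  ext c
  simp [sharpMul, sharpTwist, LinearMap.lTensor_add]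

theorem sharpMul_add (f g h : C →ₗ[R] A) :
    E.sharpMul f (g + h) = E.sharpMul f g + E.sharpMul f h :=
  LinearMap.ext fun c => evalAt_add A g h (E.sharpTwist f c)

instance : Ring E.Sharp where
  __ := (inferInstance : AddCommGroup E.Sharp)
  mul f g := E.toSharp (E.sharpMul (E.ofSharp f) (E.ofSharp g))
  one := E.toSharp (sharpConst 1)
  mul_assoc f g h := E.sharpMul_assoc (E.ofSharp f) (E.ofSharp g) (E.ofSharp h)
  one_mul f := E.one_sharpMul (E.ofSharp f)
  mul_one f := E.sharpMul_one (E.ofSharp f)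
  left_distrib f g h := E.sharpMul_add (E.ofSharp f) (E.ofSharp g) (E.ofSharp h)
  right_distrib f g h := E.add_sharpMul (E.ofSharp f) (E.ofSharp g) (E.ofSharp h)
  zero_mul f := by
    have h := E.add_sharpMul 0 0 (E.ofSharp f)
    rw [add_zero] at h
    exact left_eq_add.mp h
  mul_zero f := by
    have h := E.sharpMul_add (E.ofSharp f) 0 0
    rw [add_zero] at h
    exact left_eq_add.mp h

/-- The ring homomorphism `A → #^op_ψ(C, A)`, `a ↦ (c ↦ ε(c) a)`. -/
def ofA : A →+* E.Sharp where
  toFun a := E.toSharp (sharpConst a)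
  map_one' := rfl
  map_mul' a b := by
    refine LinearMap.ext fun c => ?_
    refine Eq.trans ?_ (E.sharpMul_const (sharpConst a) b c).symm
    exact (smul_mul_assoc (Coalgebra.counit (R := R) c) a b).symm
  map_zero' := by
    exact LinearMap.ext fun c => smul_zero (Coalgebra.counit (R := R) c)
  map_add' a b := by
    exact LinearMap.ext fun c => smul_add (Coalgebra.counit (R := R) c) a b

/-- Entwined modules are right `#^op_ψ(C, A)`-modules by `m f = ∑ m₀ f(m₁)`. -/
instance (M : E.EntwinedModule) : Module E.Sharpᵐᵒᵖ M.carrier where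
  smul f m := M.act (E.ofSharp (unop f)) m
  one_smul m := EntwinedModule.act_one E M m
  mul_smul f g m := (EntwinedModule.act_act E M (E.ofSharp (unop g)) (E.ofSharp (unop f)) m).symm
  smul_zero f := map_zero (M.act _)
  smul_add f m n := map_add (M.act _) m n
  add_smul f g m := evalAt_add M.carrier (E.ofSharp (unop f)) (E.ofSharp (unop g)) (M.coact m)
  zero_smul m := by
    have h := evalAt_add M.carrier (0 : C →ₗ[R] A) 0 (M.coact m)
    rw [add_zero] at h
    exact left_eq_add.mp h

theorem op_smul_entwined (M : E.EntwinedModule) (f : E.Sharp) (m : M.carrier) :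
    op f • m = evalAt M.carrier (E.ofSharp f) (M.coact m) := rfl

/-- The functor from entwined modules to right `#^op_ψ(C, A)`-modules which is the identity on
underlying groups and maps, with `m f = ∑ m₀ f(m₁)`. -/
def toSharpModule : E.EntwinedModule ⥤ ModuleCat.{u} E.Sharpᵐᵒᵖ where
  obj M := ModuleCat.of E.Sharpᵐᵒᵖ M.carrier
  map {M N} φ := ModuleCat.ofHom
    { toFun := φ.toLinearMap
      map_add' := map_add φ.toLinearMap
      map_smul' := fun f m => by
        obtain ⟨f, rfl⟩ := MulOpposite.op_surjective f
        simp only [RingHom.id_apply]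
        rw [op_smul_entwined, op_smul_entwined, φ.colinear]
        induction M.coact m with
        | zero => simp
        | add y z hy hz => simp only [map_add, hy, hz]
        | tmul n c => simp }
  map_id _ := rfl
  map_comp _ _ := rfl

/-- The right `#^op_ψ(C, A)`-module `A ⊗ C`, with `(a ⊗ c) f = ∑ a f(c₂)_ψ ⊗ c₁^ψ`. -/
def coringModule : ModuleCat.{u} E.Sharpᵐᵒᵖ := E.toSharpModule.obj (E.cofree A)

/-- The `α`-condition: for every right `A`-module `M` the map
`M ⊗ C → Hom(#^op_ψ(C, A), M)`, `m ⊗ c ↦ (f ↦ m f(c))`, is injective. -/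
def AlphaCondition (_E : EntwiningStructure R A C) : Prop :=
  ∀ (M : Type u) [AddCommGroup M] [Module R M] [Module Aᵐᵒᵖ M] [IsScalarTower R Aᵐᵒᵖ M],
    Function.Injective (fun (x : M ⊗[R] C) (f : C →ₗ[R] A) => evalAt M f x)

/-- A right `#^op_ψ(C, A)`-module regarded as an `R`-module and a right `A`-module by restriction
of scalars along `A → #^op_ψ(C, A)`, `a ↦ (c ↦ ε(c) a)`. -/
def Restrict (M : ModuleCat.{u} E.Sharpᵐᵒᵖ) : Type u := M

section

variable (M : ModuleCat.{u} E.Sharpᵐᵒᵖ)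

instance : AddCommGroup (E.Restrict M) := inferInstanceAs (AddCommGroup M)

instance : Module E.Sharpᵐᵒᵖ (E.Restrict M) := inferInstanceAs (Module E.Sharpᵐᵒᵖ M)

instance : Module Aᵐᵒᵖ (E.Restrict M) := Module.compHom (E.Restrict M) (RingHom.op E.ofA)

instance : Module R (E.Restrict M) := Module.compHom (E.Restrict M) (algebraMap R Aᵐᵒᵖ)

instance : IsScalarTower R Aᵐᵒᵖ (E.Restrict M) where
  smul_assoc r a m := by
    rw [Algebra.smul_def, mul_smul]
    rfl

/-- The rational part `Rat^C(M)` of a right `#^op_ψ(C, A)`-module `M`: the elements `m` for which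
there is `∑ mᵢ ⊗ cᵢ ∈ M ⊗ C` with `m f = ∑ mᵢ f(cᵢ)` for all `f`. -/
def rationalPart : Set (E.Restrict M) :=
  {m | ∃ x : E.Restrict M ⊗[R] C, ∀ f : E.Sharp, op f • m = evalAt (E.Restrict M) (E.ofSharp f) x}

end

/-- The category `Rat^C(M_{#^op_ψ(C, A)})` of `#`-rational right `#^op_ψ(C, A)`-modules `M`, i.e.
those with `Rat^C(M) = M`, as a property of right `#^op_ψ(C, A)`-modules. -/
def IsRational : ObjectProperty (ModuleCat.{u} E.Sharpᵐᵒᵖ) := fun M =>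
  E.rationalPart M = Set.univ

end Sharp

end EntwiningStructure

end

/-! Parts (2) and (3) rest on one fact: if `C` is locally projective, every tensor `x` in `N ⊗ C` is
a finite sum of terms `p_e(x) ⊗ e`, where `p_e(x)` is the contraction of `x` by a functional `p_e`
on `C` (`exists_eq_sum_contract`). Hence functionals separate tensors. Since a functional `p` yields
the element `p · 1` of `#`, evaluation at elements of `#` separates them too (`ext_evalAt`); this is
the `α`-condition. A rational element therefore has a unique representing tensor, which defines a
coaction. Evaluated at elements of `#`, the comodule axioms and the entwining condition become the
associativity and unit laws of the `#`-action (`ratEntwined`), and colinearity becomes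
`#`-linearity. So rational modules and entwined modules are the same objects with the same maps. For
`σ[A ⊗ C]`, the coaction embeds `M` into `M ⊗ C`, a quotient of a direct sum of copies of `A ⊗ C`.
Conversely, rationality passes to sums and quotients by pushing tensors forward, and to submodules
because the coefficients `p_e(x)` are obtained by acting with `p_e · 1`. If `C` is finitely
generated projective, a dual basis of all of `C` makes every `#`-module rational.

For part (1), the forgetful functor to `A`-modules is left adjoint to `- ⊗ C` and comonadic. If `C`
is flat, the comonad preserves finite limits, so the forgetful functor creates them; it also creates
colimits. Being exact and conservative, it pulls back abelianness and the exactness of filtered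
colimits from `A`-modules. For a generator, the coaction of an element involves finitely many
elements, so closing up gives a countable set whose `A`-span is, by flatness, an entwined submodule.
Such modules are quotients of one fixed free module, so they form a small family, and their
coproduct is a separator. Enough injectives then holds as in every Grothendieck category. -/

noncomputable section

/-! ### Local dual bases. -/

namespace IsLocallyProjective

variable {R W : Type u} [CommRing R] [AddCommGroup W] [Module R W]

/-- A locally projective module has a finite dual basis for each finitely generated submodule. -/
theorem exists_dualBasis (h : IsLocallyProjective R W) {F : Submodule R W} (hF : F.FG) :
    ∃ (s : Finset W) (p : W → W →ₗ[R] R), ∀ c ∈ F, ∑ e ∈ s, p e c • e = c := by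
  classical
  -- The identity of `W` is lifted, over `F`, along the free cover of `W` by its own elements; the
  -- coordinates of the lift are the functionals.
  obtain ⟨g, hg⟩ := h F hF (W →₀ R) W (Finsupp.linearCombination R id) LinearMap.id
    (Finsupp.linearCombination_id_surjective R W)
  obtain ⟨t, rfl⟩ := hF
  refine ⟨t.biUnion fun c => (g c).support, fun e => Finsupp.lapply e ∘ₗ g, fun c hc => ?_⟩
  -- One finite set serves all of `F`: the supports at the generators bound the support everywhere
  -- on their span.
  have hs : g c ∈ Finsupp.supported R R
      ((t.biUnion fun c => (g c).support : Finset W) : Set W) := by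
    refine (Submodule.span_le (p := (Finsupp.supported R R _).comap g)).2 (fun d hd => ?_) hc
    refine (Finsupp.mem_supported R _).2 fun e he => ?_
    exact Finset.mem_coe.2 (Finset.mem_biUnion.2 ⟨d, hd, he⟩)
  have h2 := hg c hc
  rw [Finsupp.linearCombination_apply, Finsupp.sum_of_support_subset _
    (by exact_mod_cast (Finsupp.mem_supported R _).1 hs) _ (by simp)] at h2
  simpa using h2

end IsLocallyProjective

/-! ### Separating tensors by functionals on `C`. -/

section Contract

variable {R C : Type u} [CommRing R] [AddCommGroup C] [Module R C]

/-- For a functional `p` on `C` the map `N ⊗ C → N`, `n ⊗ c ↦ p(c) n`. -/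
def contract (N : Type u) [AddCommGroup N] [Module R N] (p : C →ₗ[R] R) : N ⊗[R] C →ₗ[R] N :=
  (TensorProduct.rid R N).toLinearMap ∘ₗ p.lTensor N

@[simp] theorem contract_tmul (N : Type u) [AddCommGroup N] [Module R N] (p : C →ₗ[R] R)
    (n : N) (c : C) : contract N p (n ⊗ₜ c) = p c • n := by
  simp [contract]

theorem contract_rTensor {N N' : Type u} [AddCommGroup N] [Module R N] [AddCommGroup N']
    [Module R N'] (p : C →ₗ[R] R) (φ : N →ₗ[R] N') (x : N ⊗[R] C) :
    contract N' p (φ.rTensor C x) = φ (contract N p x) := by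
  induction x with
  | zero => simp
  | add y z hy hz => simp only [map_add, hy, hz]
  | tmul n c => simp

/-- The right-hand factors of a finite expression of `x` span a finitely generated submodule of `C`;
expand them in its dual basis and move the scalars to the left. -/
theorem IsLocallyProjective.exists_eq_sum_contract (h : IsLocallyProjective R C)
    {N : Type u} [AddCommGroup N] [Module R N] (x : N ⊗[R] C) :
    ∃ (s : Finset C) (p : C → C →ₗ[R] R), x = ∑ e ∈ s, contract N (p e) x ⊗ₜ[R] e := by
  classical
  obtain ⟨S, rfl⟩ := TensorProduct.exists_finset x
  obtain ⟨s, p, hp⟩ := h.exists_dualBasis (F := Submodule.span R (S.image Prod.snd : Finset C))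
    ⟨_, rfl⟩
  refine ⟨s, p, ?_⟩
  simp only [map_sum, contract_tmul, TensorProduct.sum_tmul]
  rw [Finset.sum_comm]
  refine Finset.sum_congr rfl fun i hi => ?_
  conv_lhs => rw [← hp i.2 (Submodule.subset_span (by
    exact Finset.mem_coe.2 (Finset.mem_image_of_mem _ hi)))]
  simp only [TensorProduct.tmul_sum, TensorProduct.tmul_smul, TensorProduct.smul_tmul']

theorem IsLocallyProjective.ext_contract (h : IsLocallyProjective R C)
    {N : Type u} [AddCommGroup N] [Module R N] {x y : N ⊗[R] C}
    (hxy : ∀ p : C →ₗ[R] R, contract N p x = contract N p y) : x = y := by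
  obtain ⟨s, p, hp⟩ := h.exists_eq_sum_contract (x - y)
  rw [← sub_eq_zero, hp]
  refine Finset.sum_eq_zero fun e _ => ?_
  rw [map_sub, hxy, sub_self, TensorProduct.zero_tmul]

variable {A : Type u} [Ring A] [Algebra R A]

/-- Through `p ↦ p · 1` the functionals on `C` become elements of `#`, so whatever functionals
separate, `#` separates. -/
theorem evalAt_smulRight_one (M : Type u) [AddCommGroup M] [Module R M]
    [Module Aᵐᵒᵖ M] [IsScalarTower R Aᵐᵒᵖ M] (p : C →ₗ[R] R) (x : M ⊗[R] C) :
    evalAt M (p.smulRight (1 : A)) x = contract M p x := by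
  induction x with
  | zero => simp
  | add y z hy hz => simp only [map_add, hy, hz]
  | tmul n c => simp

theorem IsLocallyProjective.ext_evalAt (h : IsLocallyProjective R C)
    {M : Type u} [AddCommGroup M] [Module R M] [Module Aᵐᵒᵖ M] [IsScalarTower R Aᵐᵒᵖ M]
    {x y : M ⊗[R] C} (hxy : ∀ f : C →ₗ[R] A, evalAt M f x = evalAt M f y) : x = y :=
  h.ext_contract fun p => by
    rw [← evalAt_smulRight_one (A := A), ← evalAt_smulRight_one (A := A), hxy]

theorem evalAt_rTensor {M N : Type u} [AddCommGroup M] [Module R M]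
    [Module Aᵐᵒᵖ M] [IsScalarTower R Aᵐᵒᵖ M] [AddCommGroup N] [Module R N]
    [Module Aᵐᵒᵖ N] [IsScalarTower R Aᵐᵒᵖ N] (f : C →ₗ[R] A) (φ : M →ₗ[R] N)
    (hφ : ∀ (a : A) (m : M), φ (op a • m) = op a • φ m) (x : M ⊗[R] C) :
    evalAt N f (φ.rTensor C x) = φ (evalAt M f x) := by
  induction x with
  | zero => simp
  | add y z hy hz => simp only [map_add, hy, hz]
  | tmul n c => simp [hφ]

end Contract

theorem IsLocallyProjective.of_projective {R W : Type u} [CommRing R] [AddCommGroup W]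
    [Module R W] [Module.Projective R W] : IsLocallyProjective R W := by
  intro F _ L N _ _ _ _ p g hp
  obtain ⟨g', hg'⟩ := Module.projective_lifting_property p g hp
  exact ⟨g', fun x _ => LinearMap.congr_fun hg' x⟩

/-- An isomorphism of categories requires objects to be equal, not merely isomorphic. -/
theorem ModuleCat.of_eq_of {S : Type u} [Ring S] {X : Type u} [AddCommGroup X]
    (i j : Module S X) (h : ∀ (s : S) (x : X), (letI := i; s • x) = (letI := j; s • x)) :
    @ModuleCat.of S _ X _ i = @ModuleCat.of S _ X _ j := by
  have : i = j := Module.ext' i j h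
  subst this
  rfl

/-! ### The entwined module axioms as identities in `#`. -/

namespace EntwiningStructure

variable {R A C : Type u} [CommRing R] [Ring A] [Algebra R A]
  [AddCommGroup C] [Module R C] [Coalgebra R C] (E : EntwiningStructure R A C)

theorem alphaCondition_of_isLocallyProjective (h : IsLocallyProjective R C) :
    E.AlphaCondition := by
  intro M _ _ _ _ x y hxy
  exact h.ext_evalAt fun f => congrFun hxy f

theorem sharpTwist_sharpConst (a : A) (c : C) :
    E.sharpTwist (sharpConst a) c = E.psi (c ⊗ₜ a) := by
  have h := congrArg (TensorProduct.rid R C) (Coalgebra.lTensor_counit_comul (R := R) c)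
  rw [TensorProduct.rid_tmul, one_smul] at h
  have h2 (z : C ⊗[R] C) : (sharpConst (R := R) a).lTensor C z =
      TensorProduct.rid R C ((Coalgebra.counit (R := R) (A := C)).lTensor C z) ⊗ₜ[R] a := by
    induction z with
    | zero => simp
    | add y z hy hz => simp only [map_add, hy, hz, TensorProduct.add_tmul]
    | tmul x y => simp [sharpConst, TensorProduct.tmul_smul, TensorProduct.smul_tmul']
  rw [sharpTwist, LinearMap.comp_apply, LinearMap.comp_apply, h2, h]

/-- This tests the entwining condition against `#`: twisting by `a` amounts to multiplying on the
left by `ε(-)a`. -/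
theorem evalAt_twist (M : Type u) [AddCommGroup M] [Module R M] [Module Aᵐᵒᵖ M]
    [IsScalarTower R Aᵐᵒᵖ M] (f : C →ₗ[R] A) (a : A) (x : M ⊗[R] C) :
    evalAt M f (E.twist M (x ⊗ₜ a)) = evalAt M (E.sharpMul (sharpConst a) f) x := by
  induction x with
  | zero => simp
  | add y z hy hz => simp only [map_add, hy, hz, TensorProduct.add_tmul]
  | tmul m c =>
    rw [twist_tmul, evalAt_tmul, sharpMul, LinearMap.comp_apply, sharpTwist_sharpConst]
    induction E.psi (c ⊗ₜ a) with
    | zero => simp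
    | add y z hy hz => simp only [map_add, hy, hz, MulOpposite.op_add, add_smul]
    | tmul b d => simp [mul_smul]

/-- This turns coassociativity into a statement about products in `#`. The entwining map drops out
because `q · 1` has values in `R · 1`, where `psi_one` applies. -/
theorem contract_contract_comul {N : Type u} [AddCommGroup N] [Module R N] [Module Aᵐᵒᵖ N]
    [IsScalarTower R Aᵐᵒᵖ N] (p q : C →ₗ[R] R) (x : N ⊗[R] C) :
    contract N p (contract (N ⊗[R] C) q ((TensorProduct.assoc R N C C).symm
      ((Coalgebra.comul (R := R) (A := C)).lTensor N x))) =
      evalAt N (E.sharpMul (q.smulRight (1 : A)) (p.smulRight (1 : A))) x := by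
  induction x with
  | zero => simp
  | add y z hy hz => simp only [map_add, hy, hz]
  | tmul n c =>
    simp only [LinearMap.lTensor_tmul, evalAt_tmul, sharpMul, sharpTwist, LinearMap.comp_apply]
    induction Coalgebra.comul (R := R) c with
    | zero => simp
    | add y z hy hz =>
      simp only [TensorProduct.tmul_add, map_add, hy, hz, MulOpposite.op_add, add_smul]
    | tmul a b =>
      simp [TensorProduct.tmul_smul, E.psi_one, smul_smul, mul_comm]

theorem sharpMul_sharpConst_algebraMap (r : R) (f : C →ₗ[R] A) :
    E.sharpMul (sharpConst (algebraMap R A r)) f = r • f := by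
  ext c
  simp only [sharpMul, LinearMap.comp_apply, sharpTwist_sharpConst, Algebra.algebraMap_eq_smul_one,
    TensorProduct.tmul_smul, map_smul, E.psi_one, evalAt_tmul, LinearMap.smul_apply]
  simp

/-! ### Rational `#`-modules are entwined modules. -/

section Rational

variable {E} (M : ModuleCat.{u} E.Sharpᵐᵒᵖ)

theorem restrict_op_smul (a : A) (m : E.Restrict M) : op a • m = op (E.ofA a) • m := rfl

theorem restrict_smul (r : R) (m : E.Restrict M) :
    r • m = op (E.ofA (algebraMap R A r)) • m := rfl

theorem restrict_smul_smul (f g : C →ₗ[R] A) (m : E.Restrict M) :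
    op (E.toSharp g) • op (E.toSharp f) • m = op (E.toSharp (E.sharpMul f g)) • m :=
  (mul_smul (op (E.toSharp g)) (op (E.toSharp f)) m).symm

/-- The image of `R` is central in `#`: both products of `f` with `ε(-)r` equal `r • f`. This makes
the coaction `ratCoact` linear over `R`. -/
theorem restrict_smul_comm (r : R) (f : C →ₗ[R] A) (m : E.Restrict M) :
    op (E.toSharp f) • r • m = r • op (E.toSharp f) • m := by
  rw [restrict_smul, restrict_smul]
  change op (E.toSharp f) • op (E.toSharp _) • m = op (E.toSharp _) • op (E.toSharp f) • m
  rw [restrict_smul_smul, restrict_smul_smul, sharpMul_sharpConst_algebraMap]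
  congr 3
  ext c
  rw [sharpMul_const, LinearMap.smul_apply, ← Algebra.commutes, Algebra.smul_def]

variable {M}

/-- `x ∈ M ⊗ C` represents the action of `#` on `m`. -/
def Represents (m : E.Restrict M) (x : E.Restrict M ⊗[R] C) : Prop :=
  ∀ f : C →ₗ[R] A, op (E.toSharp f) • m = evalAt (E.Restrict M) f x

theorem isRational_iff : E.IsRational M ↔ ∀ m : E.Restrict M, ∃ x, Represents m x :=
  Set.eq_univ_iff_forall

theorem Represents.add {m n : E.Restrict M} {x y : E.Restrict M ⊗[R] C} (hx : Represents m x)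
    (hy : Represents n y) : Represents (m + n) (x + y) := fun f => by
  rw [smul_add, map_add, hx, hy]

theorem Represents.smul {m : E.Restrict M} {x : E.Restrict M ⊗[R] C} (hx : Represents m x)
    (r : R) : Represents (r • m) (r • x) := fun f => by
  rw [restrict_smul_comm, map_smul, hx]

theorem Represents.unique (h : IsLocallyProjective R C) {m : E.Restrict M}
    {x y : E.Restrict M ⊗[R] C} (hx : Represents m x) (hy : Represents m y) : x = y :=
  h.ext_evalAt fun f => by rw [← hx, ← hy]

/-- The coaction on a rational module. -/
def ratCoact (h : IsLocallyProjective R C) (hM : E.IsRational M) :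
    E.Restrict M →ₗ[R] E.Restrict M ⊗[R] C where
  toFun m := (isRational_iff.1 hM m).choose
  map_add' m n := Represents.unique h (isRational_iff.1 hM _).choose_spec
    ((isRational_iff.1 hM m).choose_spec.add (isRational_iff.1 hM n).choose_spec)
  map_smul' r m := Represents.unique h (isRational_iff.1 hM _).choose_spec
    ((isRational_iff.1 hM m).choose_spec.smul r)

theorem represents_ratCoact (h : IsLocallyProjective R C) (hM : E.IsRational M)
    (m : E.Restrict M) : Represents m (ratCoact h hM m) :=
  (isRational_iff.1 hM m).choose_spec

/-- A rational `#`-module as an entwined module. -/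
def ratEntwined (h : IsLocallyProjective R C) (hM : E.IsRational M) : E.EntwinedModule where
  carrier := E.Restrict M
  coact := ratCoact h hM
  coassoc m := by
    rw [← LinearEquiv.eq_symm_apply]
    -- After contraction by `q` and `p`, one side is `(m (q · 1)) (p · 1)` and the other is `m`
    -- acted on by the product of `q · 1` and `p · 1`.
    refine h.ext_contract fun q => h.ext_contract fun p => ?_
    rw [E.contract_contract_comul, contract_rTensor, ← evalAt_smulRight_one (A := A),
      ← evalAt_smulRight_one (A := A), ← represents_ratCoact h hM, ← represents_ratCoact h hM,
      ← represents_ratCoact h hM, restrict_smul_smul]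
  counit m := by
    have h1 := represents_ratCoact h hM m (sharpConst 1)
    rw [evalAt_sharpConst, op_one, one_smul] at h1
    rw [← h1]
    exact one_smul E.Sharpᵐᵒᵖ m
  compat m a := by
    -- Evaluated at `f`, the two sides are `(m a) f` and `m (ε(-)a · f)`.
    refine h.ext_evalAt (A := A) fun f => ?_
    rw [evalAt_twist, ← represents_ratCoact h hM, ← represents_ratCoact h hM,
      ← restrict_smul_smul]
    rfl

theorem toSharpModule_obj_ratEntwined (h : IsLocallyProjective R C) (hM : E.IsRational M) :
    E.toSharpModule.obj (ratEntwined h hM) = M := by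
  refine (ModuleCat.of_eq_of (S := E.Sharpᵐᵒᵖ) (X := M) _ _ fun f m => ?_)
  exact (represents_ratCoact h hM m (E.ofSharp (unop f))).symm

variable {M' : ModuleCat.{u} E.Sharpᵐᵒᵖ}

/-- A `#`-linear map as an `R`-linear map. -/
def restrictMap (φ : M →ₗ[E.Sharpᵐᵒᵖ] M') : E.Restrict M →ₗ[R] E.Restrict M' where
  toFun := φ
  map_add' := map_add φ
  map_smul' r n := φ.map_smul (op (E.ofA (algebraMap R A r))) n

theorem restrictMap_sharp_smul (φ : M →ₗ[E.Sharpᵐᵒᵖ] M') (f : E.Sharp) (m : E.Restrict M) :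
    restrictMap φ (op f • m) = op f • restrictMap φ m :=
  φ.map_smul (op f) m

theorem restrictMap_smul (φ : M →ₗ[E.Sharpᵐᵒᵖ] M') (a : A) (m : E.Restrict M) :
    restrictMap φ (op a • m) = op a • restrictMap φ m :=
  φ.map_smul (op (E.ofA a)) m

theorem Represents.map (φ : M →ₗ[E.Sharpᵐᵒᵖ] M') {m : E.Restrict M}
    {x : E.Restrict M ⊗[R] C} (hx : Represents m x) :
    Represents (restrictMap φ m) ((restrictMap φ).rTensor C x) := fun f => by
  rw [evalAt_rTensor _ _ (restrictMap_smul φ), ← hx, restrictMap_sharp_smul]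

/-- Write `x` as the sum of `p_e(x) ⊗ e`. Since `x` represents `φ m`, each coefficient is `φ m`
acted on by `p_e · 1`, hence lies in the image of `φ`. So `x` lifts, and injectivity of `φ` shows
that the lift represents `m`. -/
theorem Represents.of_injective (h : IsLocallyProjective R C)
    (φ : M →ₗ[E.Sharpᵐᵒᵖ] M') (hφ : Function.Injective φ)
    {m : E.Restrict M} {x : E.Restrict M' ⊗[R] C} (hx : Represents (restrictMap φ m) x) :
    ∃ x, Represents m x := by
  obtain ⟨s, p, hp⟩ := h.exists_eq_sum_contract x
  obtain ⟨y, rfl⟩ : ∃ y, (restrictMap φ).rTensor C y = x := by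
    refine ⟨∑ e ∈ s, (op (E.toSharp ((p e).smulRight (1 : A))) • m) ⊗ₜ e, ?_⟩
    conv_rhs => rw [hp]
    simp only [map_sum, LinearMap.rTensor_tmul, restrictMap_sharp_smul]
    refine Finset.sum_congr rfl fun e _ => ?_
    rw [hx, evalAt_smulRight_one]
  refine ⟨y, fun f => ?_⟩
  have hf : restrictMap φ (op (E.toSharp f) • m) = restrictMap φ (evalAt (E.Restrict M) f y) := by
    rw [restrictMap_sharp_smul, hx, evalAt_rTensor _ _ (restrictMap_smul φ)]
  exact hφ hf

theorem isRational_toSharpModule_obj (N : E.EntwinedModule) :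
    E.IsRational (E.toSharpModule.obj N) := by
  refine isRational_iff.2 fun m => ?_
  have hA (a : A) (n : N.carrier) : op (E.ofA a) • n = op a • n := EntwinedModule.act_const E N a n
  -- The identity map, from the given `R`-structure of `N` to the one restricted from `#`; the two
  -- agree because `ε(-)a` acts as `a`.
  let ψ : N.carrier →ₗ[R] E.Restrict (E.toSharpModule.obj N) :=
    { toFun := fun n => n
      map_add' := fun _ _ => rfl
      map_smul' := fun r n => by
        refine Eq.trans ?_ (hA (algebraMap R A r) n).symm
        rw [Algebra.algebraMap_eq_smul_one, op_smul, smul_assoc, op_one, one_smul] }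
  refine ⟨ψ.rTensor C (N.coact m), fun f => ?_⟩
  rw [evalAt_rTensor (hφ := fun a n => (hA a n).symm)]
  rfl

end Rational

end EntwiningStructure

/-- Used to show that the `#`-module determines the entwined module as an object, not only up to
isomorphism. -/
theorem ModuleCat.heq_of_eq {S : Type u} [Ring S] {M N : ModuleCat.{u} S} (h : M = N) :
    (M : Type u) = N ∧ M.isAddCommGroup ≍ N.isAddCommGroup ∧ M.isModule ≍ N.isModule := by
  subst h
  exact ⟨rfl, .rfl, .rfl⟩

/-! ### The category `σ[A ⊗ C]` and the isomorphisms of categories. -/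

namespace EntwiningStructure

variable {R A C : Type u} [CommRing R] [Ring A] [Algebra R A]
  [AddCommGroup C] [Module R C] [Coalgebra R C] {E : EntwiningStructure R A C}

variable (E) in
/-- For an `A`-linear map `f : M → N`, the `A`-linear map `f ⊗ C : M ⊗ C → N ⊗ C`. -/
def cofreeLinearMap {M N : Type u} [AddCommGroup M] [Module R M] [Module Aᵐᵒᵖ M]
    [IsScalarTower R Aᵐᵒᵖ M] [AddCommGroup N] [Module R N] [Module Aᵐᵒᵖ N]
    [IsScalarTower R Aᵐᵒᵖ N] (f : M →ₗ[Aᵐᵒᵖ] N) :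
    E.Cofree M →ₗ[Aᵐᵒᵖ] E.Cofree N where
  toFun x := E.toCofree N ((f.restrictScalars R).rTensor C ((E.toCofree M).symm x))
  map_add' x y := by simp only [map_add]
  map_smul' a x := by
    obtain ⟨x, rfl⟩ := (E.toCofree M).surjective x
    obtain ⟨a, rfl⟩ := MulOpposite.op_surjective a
    simp only [RingHom.id_apply, op_smul_toCofree, LinearEquiv.symm_apply_apply]
    refine congrArg (E.toCofree N) ?_
    induction x with
    | zero => simp
    | add y z hy hz => simp only [TensorProduct.add_tmul, map_add, hy, hz]
    | tmul m c =>
      simp only [LinearMap.rTensor_tmul, twist_tmul]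
      induction E.psi (c ⊗ₜ a) with
      | zero => simp
      | add y z hy hz => simp only [map_add, hy, hz]
      | tmul b d => simp

theorem cofreeLinearMap_toCofree {M N : Type u} [AddCommGroup M] [Module R M] [Module Aᵐᵒᵖ M]
    [IsScalarTower R Aᵐᵒᵖ M] [AddCommGroup N] [Module R N] [Module Aᵐᵒᵖ N]
    [IsScalarTower R Aᵐᵒᵖ N] (f : M →ₗ[Aᵐᵒᵖ] N)
    (x : M ⊗[R] C) : E.cofreeLinearMap f (E.toCofree M x) =
      E.toCofree N ((f.restrictScalars R).rTensor C x) := rfl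

theorem cofreeCoact_cofreeLinearMap {M N : Type u} [AddCommGroup M] [Module R M] [Module Aᵐᵒᵖ M]
    [IsScalarTower R Aᵐᵒᵖ M] [AddCommGroup N] [Module R N] [Module Aᵐᵒᵖ N]
    [IsScalarTower R Aᵐᵒᵖ N] (f : M →ₗ[Aᵐᵒᵖ] N)
    (x : E.Cofree M) : E.cofreeCoact N (E.cofreeLinearMap f x) =
      ((E.cofreeLinearMap f).restrictScalars R).rTensor C (E.cofreeCoact M x) := by
  obtain ⟨x, rfl⟩ := (E.toCofree M).surjective x
  rw [cofreeLinearMap_toCofree, cofreeCoact_toCofree, cofreeCoact_toCofree]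
  induction x with
  | zero => simp
  | add y z hy hz => simp only [map_add, hy, hz]
  | tmul m c =>
    simp only [LinearMap.rTensor_tmul, LinearMap.lTensor_tmul]
    induction Coalgebra.comul (R := R) c with
    | zero => simp
    | add y z hy hz => simp only [TensorProduct.tmul_add, map_add, hy, hz]
    | tmul b d => simp [cofreeLinearMap_toCofree]

/-- For an `A`-linear map `f : M → N`, the morphism `f ⊗ C : M ⊗ C → N ⊗ C` of entwined modules. -/
def cofreeMap {M N : Type u} [AddCommGroup M] [Module R M] [Module Aᵐᵒᵖ M]
    [IsScalarTower R Aᵐᵒᵖ M] [AddCommGroup N] [Module R N] [Module Aᵐᵒᵖ N]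
    [IsScalarTower R Aᵐᵒᵖ N] (f : M →ₗ[Aᵐᵒᵖ] N) :
    E.cofree M ⟶ E.cofree N where
  toLinearMap := E.cofreeLinearMap f
  colinear := cofreeCoact_cofreeLinearMap f

/-- The coaction as an `A`-linear map. -/
def coactLinearMap (M : E.EntwinedModule) : M.carrier →ₗ[Aᵐᵒᵖ] E.Cofree M.carrier where
  toFun m := E.toCofree M.carrier (M.coact m)
  map_add' x y := by simp only [map_add]
  map_smul' a x := by
    obtain ⟨a, rfl⟩ := MulOpposite.op_surjective a
    rw [M.compat, RingHom.id_apply, op_smul_toCofree]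

/-- The coaction as a morphism of entwined modules `M → M ⊗ C`. -/
def coactHom (M : E.EntwinedModule) : M ⟶ E.cofree M.carrier where
  toLinearMap := coactLinearMap M
  colinear m := by
    change E.cofreeCoact M.carrier (E.toCofree M.carrier (M.coact m)) =
      LinearMap.rTensor C ((E.toCofree M.carrier).toLinearMap ∘ₗ M.coact) (M.coact m)
    rw [cofreeCoact_toCofree, LinearMap.rTensor_comp_apply, ← M.coassoc,
      LinearEquiv.symm_apply_apply]

theorem coact_injective (M : E.EntwinedModule) : Function.Injective M.coact := fun x y h => by
  rw [← M.counit x, ← M.counit y, h]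

/-- The coaction embeds `M` into `M ⊗ C`, being split by the counit. The maps `a ⊗ c ↦ m a ⊗ c`, one
for each `m`, jointly cover `M ⊗ C` by copies of `A ⊗ C`. -/
theorem isSubgenerated_toSharpModule_obj (M : E.EntwinedModule) :
    IsSubgenerated E.coringModule (E.toSharpModule.obj M) := by
  let g (m : M.carrier) : A →ₗ[Aᵐᵒᵖ] M.carrier :=
    { toFun := fun a => op a • m
      map_add' := fun a b => by rw [MulOpposite.op_add, add_smul]
      map_smul' := fun a b => by
        obtain ⟨a, rfl⟩ := MulOpposite.op_surjective a
        rw [op_smul_eq_mul, op_mul, mul_smul, RingHom.id_apply] }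
  let F (m : M.carrier) : E.coringModule →ₗ[E.Sharpᵐᵒᵖ] E.toSharpModule.obj (E.cofree M.carrier) :=
    (E.toSharpModule.map (cofreeMap (g m))).hom
  refine ⟨M.carrier, E.toSharpModule.obj (E.cofree M.carrier), Finsupp.lsum ℕ F,
    (E.toSharpModule.map (coactHom M)).hom, fun x => ?_, fun x y h => coact_injective M h⟩
  obtain ⟨x, rfl⟩ := (E.toCofree M.carrier).surjective x
  induction x with
  | zero => exact ⟨0, map_zero _⟩
  | add y z hy hz =>
    obtain ⟨y', rfl⟩ := hy
    obtain ⟨z', rfl⟩ := hz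
    exact ⟨y' + z', map_add _ _ _⟩
  | tmul m c =>
    refine ⟨Finsupp.single m (E.toCofree A (1 ⊗ₜ c)), (Finsupp.lsum_single ℕ F m _).trans ?_⟩
    change E.toCofree _ ((op (1 : A) • m) ⊗ₜ c) = _
    rw [op_one, one_smul]

/-- Sums and quotients inherit representing tensors directly; only the passage to the submodule uses
local projectivity. -/
theorem IsSubgenerated.isRational (h : IsLocallyProjective R C) {N : ModuleCat.{u} E.Sharpᵐᵒᵖ}
    (hN : IsSubgenerated E.coringModule N) : E.IsRational N := by
  obtain ⟨I, P, q, j, hq, hj⟩ := hN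
  have hz (z : I →₀ E.coringModule) : ∃ x, Represents (M := P) (q z : P) x := by
    induction z using Finsupp.induction_linear with
    | zero => exact ⟨0, fun f => by rw [map_zero, map_zero]; exact smul_zero (A := P) _⟩
    | add y z hy hz =>
      obtain ⟨y', hy⟩ := hy
      obtain ⟨z', hz⟩ := hz
      refine ⟨y' + z', ?_⟩
      rw [map_add]
      exact hy.add hz
    | single i k =>
      obtain ⟨x, hx⟩ := isRational_iff.1 (isRational_toSharpModule_obj (E.cofree A)) k
      exact ⟨_, hx.map (q ∘ₗ Finsupp.lsingle i)⟩
  refine isRational_iff.2 fun m => ?_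
  obtain ⟨z, hz'⟩ := hq (j m)
  obtain ⟨x, hx⟩ := hz z
  rw [hz'] at hx
  exact Represents.of_injective h j hj hx

theorem isRational_eq_isSubgenerated (h : IsLocallyProjective R C) :
    E.IsRational = IsSubgenerated E.coringModule := by
  ext N
  refine ⟨fun hN => ?_, IsSubgenerated.isRational h⟩
  rw [← toSharpModule_obj_ratEntwined h hN]
  exact isSubgenerated_toSharpModule_obj _

instance toSharpModule_faithful : E.toSharpModule.Faithful where
  map_injective {M N} f g hfg := by
    refine EntwinedModule.Hom.ext (LinearMap.ext fun m => ?_)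
    exact LinearMap.congr_fun (congrArg ModuleCat.Hom.hom hfg) m

/-- Linearity over the elements `ε(-)a` gives `A`-linearity; colinearity is an equality in `N ⊗ C`
and can be tested by evaluation at `#`. -/
theorem toSharpModule_full (h : IsLocallyProjective R C) : E.toSharpModule.Full where
  map_surjective {M N} φ := by
    have hsharp (f : C →ₗ[R] A) (m : M.carrier) : φ.hom (M.act f m) = N.act f (φ.hom m) :=
      φ.hom.map_smul (op (E.toSharp f)) m
    let φA : M.carrier →ₗ[Aᵐᵒᵖ] N.carrier :=
      { toFun := fun m => φ.hom m
        map_add' := map_add φ.hom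
        map_smul' := fun a m => by
          obtain ⟨a, rfl⟩ := MulOpposite.op_surjective a
          rw [← EntwinedModule.act_const E M a m]
          exact (hsharp _ m).trans (EntwinedModule.act_const E N a _) }
    refine ⟨⟨φA, fun m => h.ext_evalAt (A := A) fun f => ?_⟩, rfl⟩
    rw [evalAt_rTensor _ _ (fun a m => φA.map_smul _ _)]
    exact (hsharp f m).symm

theorem EntwinedModule.smul_eq (M : E.EntwinedModule) (r : R) (m : M.carrier) :
    r • m = op (algebraMap R A r) • m := by
  rw [Algebra.algebraMap_eq_smul_one, op_smul, smul_assoc, op_one, one_smul]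

theorem toSharpModule_obj_injective (h : IsLocallyProjective R C) :
    Function.Injective E.toSharpModule.obj := by
  intro M N hMN
  obtain ⟨X, ρ, h1, h2, h3⟩ := M
  obtain ⟨Y, σ, k1, k2, k3⟩ := N
  rename_i iX mX aX tX iY mY aY tY
  obtain ⟨rfl, hi, hm⟩ := ModuleCat.heq_of_eq hMN
  obtain rfl := eq_of_heq hi
  have hact (f : C →ₗ[R] A) (m : X) :
      (EntwinedModule.mk (E := E) X ρ h1 h2 h3).act f m =
        (@EntwinedModule.mk _ _ _ _ _ _ _ _ _ E X _ mY aY tY σ k1 k2 k3).act f m :=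
    congrArg (fun i : Module E.Sharpᵐᵒᵖ X => i.smul (op (E.toSharp f)) m) (eq_of_heq hm)
  -- The structures are recovered from the `#`-action one by one: the `A`-action from `ε(-)a`, the
  -- `R`-action from the `A`-action, and finally the coaction by separation.
  have hA : aX = aY := Module.ext' _ _ fun a m => by
    refine Eq.trans ?_ ((hact (sharpConst (unop a)) m).trans ?_)
    · exact (EntwinedModule.act_const E ⟨X, ρ, h1, h2, h3⟩ (unop a) m).symm
    · exact EntwinedModule.act_const E
        (@EntwinedModule.mk _ _ _ _ _ _ _ _ _ E X _ mY aY tY σ k1 k2 k3) (unop a) m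
  subst hA
  have hR : mX = mY := Module.ext' _ _ fun r m =>
    (EntwinedModule.smul_eq ⟨X, ρ, h1, h2, h3⟩ r m).trans (EntwinedModule.smul_eq
        (@EntwinedModule.mk _ _ _ _ _ _ _ _ _ E X _ mY aX tY σ k1 k2 k3) r m).symm
  subst hR
  obtain rfl : ρ = σ := LinearMap.ext fun m => h.ext_evalAt fun f => hact f m
  rfl

theorem isIsomorphismOfCategories_lift (h : IsLocallyProjective R C)
    (P : ObjectProperty (ModuleCat.{u} E.Sharpᵐᵒᵖ)) (hP : E.IsRational = P)
    (hE : ∀ M, P (E.toSharpModule.obj M)) :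
    IsIsomorphismOfCategories (P.lift E.toSharpModule hE) := by
  subst hP
  have := toSharpModule_full (E := E) h
  refine ⟨inferInstance, inferInstance, fun M N hMN => ?_, fun N => ?_⟩
  · exact toSharpModule_obj_injective h (congrArg ObjectProperty.FullSubcategory.obj hMN)
  · obtain ⟨N, hN⟩ := N
    refine ⟨ratEntwined h hN, ?_⟩
    have := toSharpModule_obj_ratEntwined h hN
    exact ObjectProperty.FullSubcategory.ext this

/-- With a dual basis of all of `C`, every `f` in `#` is the sum of the products `(p_e · 1) · (ε(-)
f(e))`, so `m` is represented by the sum of the `m (p_e · 1) ⊗ e`. -/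
theorem isRational_of_finite_projective [Module.Finite R C] [Module.Projective R C]
    (N : ModuleCat.{u} E.Sharpᵐᵒᵖ) : E.IsRational N := by
  obtain ⟨s, p, hp⟩ := (IsLocallyProjective.of_projective (R := R) (W := C)).exists_dualBasis
    (F := ⊤) Module.Finite.fg_top
  refine isRational_iff.2 fun m =>
    ⟨∑ e ∈ s, (op (E.toSharp ((p e).smulRight (1 : A))) • m) ⊗ₜ e, fun f => ?_⟩
  simp only [map_sum, evalAt_tmul, restrict_op_smul]
  have hf : f = ∑ e ∈ s, E.sharpMul ((p e).smulRight (1 : A)) (sharpConst (f e)) := by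
    ext c
    conv_lhs => rw [← hp c trivial]
    simp [sharpMul_const]
  have hs (e : C) : op (E.ofA (f e)) • op (E.toSharp ((p e).smulRight (1 : A))) • m =
      op (E.toSharp (E.sharpMul ((p e).smulRight (1 : A)) (sharpConst (f e)))) • m :=
    restrict_smul_smul _ _ _ _
  simp only [hs]
  conv_lhs => rw [hf]
  rw [map_sum, ← Finset.sum_smul, Finset.op_sum]

theorem isIsomorphismOfCategories_toSharpModule [Module.Finite R C] [Module.Projective R C] :
    IsIsomorphismOfCategories E.toSharpModule where
  full := toSharpModule_full .of_projective
  faithful := inferInstance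
  bijective_obj := ⟨toSharpModule_obj_injective .of_projective, fun N =>
    ⟨_, toSharpModule_obj_ratEntwined .of_projective (isRational_of_finite_projective N)⟩⟩

end EntwiningStructure

/-! ### Comonadicity of the forgetful functor to `A`-modules. -/

namespace EntwiningStructure

open Limits

variable {R A C : Type u} [CommRing R] [Ring A] [Algebra R A]
  [AddCommGroup C] [Module R C] [Coalgebra R C] {E : EntwiningStructure R A C}

section

variable {M N P : Type u} [AddCommGroup M] [Module R M] [Module Aᵐᵒᵖ M] [IsScalarTower R Aᵐᵒᵖ M]
  [AddCommGroup N] [Module R N] [Module Aᵐᵒᵖ N] [IsScalarTower R Aᵐᵒᵖ N]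
  [AddCommGroup P] [Module R P] [Module Aᵐᵒᵖ P] [IsScalarTower R Aᵐᵒᵖ P]

theorem cofreeLinearMap_comp_apply (g : N →ₗ[Aᵐᵒᵖ] P) (f : M →ₗ[Aᵐᵒᵖ] N) (x : E.Cofree M) :
    E.cofreeLinearMap (g ∘ₗ f) x = E.cofreeLinearMap g (E.cofreeLinearMap f x) :=
  LinearMap.rTensor_comp_apply C (g.restrictScalars R) (f.restrictScalars R)
    ((E.toCofree M).symm x)

theorem cofreeLinearMap_id (x : E.Cofree M) :
    E.cofreeLinearMap (LinearMap.id : M →ₗ[Aᵐᵒᵖ] M) x = x :=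
  LinearMap.rTensor_id_apply C M ((E.toCofree M).symm x)

theorem cofreeLinearMap_add (f g : M →ₗ[Aᵐᵒᵖ] N) :
    E.cofreeLinearMap (f + g) = E.cofreeLinearMap f + E.cofreeLinearMap g := by
  ext x
  exact LinearMap.congr_fun
    (LinearMap.rTensor_add C (f.restrictScalars R) (g.restrictScalars R)) ((E.toCofree M).symm x)

variable (E M) in
/-- The counit `m ⊗ c ↦ ε(c) m` of `M ⊗ C`. -/
def counitLinearMap : E.Cofree M →ₗ[Aᵐᵒᵖ] M where
  toFun x := contract M (Coalgebra.counit (R := R) (A := C)) ((E.toCofree M).symm x)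
  map_add' x y := by simp only [map_add]
  map_smul' a x := by
    obtain ⟨x, rfl⟩ := (E.toCofree M).surjective x
    obtain ⟨a, rfl⟩ := MulOpposite.op_surjective a
    simp only [RingHom.id_apply, op_smul_toCofree, LinearEquiv.symm_apply_apply]
    rw [← evalAt_smulRight_one (A := A), ← evalAt_smulRight_one (A := A)]
    change evalAt M (sharpConst 1) _ = op a • evalAt M (sharpConst 1) _
    rw [evalAt_twist, sharpMul_one, evalAt_sharpConst, evalAt_sharpConst, op_one, one_smul]

theorem counitLinearMap_toCofree (x : M ⊗[R] C) : E.counitLinearMap M (E.toCofree M x) =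
    TensorProduct.rid R M ((Coalgebra.counit (R := R) (A := C)).lTensor M x) := rfl

theorem counitLinearMap_cofreeLinearMap (f : M →ₗ[Aᵐᵒᵖ] N) (x : E.Cofree M) :
    E.counitLinearMap N (E.cofreeLinearMap f x) = f (E.counitLinearMap M x) :=
  contract_rTensor _ (f.restrictScalars R) ((E.toCofree M).symm x)

/-- The left counit law of `C`; this carries the second triangle identity of the adjunction. -/
theorem cofreeLinearMap_counitLinearMap (x : E.Cofree M) :
    E.cofreeLinearMap (E.counitLinearMap M) (E.toCofree _ (E.cofreeCoact M x)) = x := by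
  obtain ⟨x, rfl⟩ := (E.toCofree M).surjective x
  rw [cofreeCoact_toCofree, cofreeLinearMap_toCofree]
  refine congrArg (E.toCofree M) ?_
  induction x with
  | zero => simp
  | add y z hy hz => simp only [map_add, hy, hz]
  | tmul m c =>
    rw [LinearMap.lTensor_tmul]
    have h := congrArg (TensorProduct.lid R C) (Coalgebra.rTensor_counit_comul (R := R) c)
    rw [TensorProduct.lid_tmul, one_smul] at h
    have h2 (z : C ⊗[R] C) : ((E.counitLinearMap M).restrictScalars R).rTensor C
        ((E.toCofree M).toLinearMap.rTensor C ((TensorProduct.assoc R M C C).symm (m ⊗ₜ z))) =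
        m ⊗ₜ TensorProduct.lid R C ((Coalgebra.counit (R := R) (A := C)).rTensor C z) := by
      induction z with
      | zero => simp
      | add y z hy hz => simp only [TensorProduct.tmul_add, map_add, hy, hz]
      | tmul a b => simp [counitLinearMap_toCofree, TensorProduct.smul_tmul]
    rw [h2, h]

end

/-- An `A`-module as an `R`-module. -/
def ScalarRestrict (R : Type u) {A : Type u} [CommRing R] [Ring A] [Algebra R A]
    (N : ModuleCat.{u} Aᵐᵒᵖ) : Type u := N

section

variable (N : ModuleCat.{u} Aᵐᵒᵖ)

instance : AddCommGroup (ScalarRestrict R N) := inferInstanceAs (AddCommGroup N)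

instance : Module Aᵐᵒᵖ (ScalarRestrict R N) := inferInstanceAs (Module Aᵐᵒᵖ N)

instance : Module R (ScalarRestrict R N) := Module.restrictScalars R Aᵐᵒᵖ (ScalarRestrict R N)

instance : IsScalarTower R Aᵐᵒᵖ (ScalarRestrict R N) :=
  IsScalarTower.restrictScalars R Aᵐᵒᵖ (ScalarRestrict R N)

variable (R) in
/-- The identity `N → ScalarRestrict R N`. -/
def toScalarRestrict : N ≃ₗ[Aᵐᵒᵖ] ScalarRestrict R N := LinearEquiv.refl _ _

end

/-- A morphism of right `A`-modules as a linear map. -/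
def scalarRestrictMap {N P : ModuleCat.{u} Aᵐᵒᵖ} (f : N ⟶ P) :
    ScalarRestrict R N →ₗ[Aᵐᵒᵖ] ScalarRestrict R P := f.hom

variable (E) in
/-- The functor from entwined modules to right `A`-modules. -/
def forgetToModule : E.EntwinedModule ⥤ ModuleCat.{u} Aᵐᵒᵖ where
  obj M := ModuleCat.of Aᵐᵒᵖ M.carrier
  map f := ModuleCat.ofHom f.toLinearMap

variable (E) in
/-- The functor `N ↦ N ⊗ C` from right `A`-modules to entwined modules. -/
def cofreeFunctor : ModuleCat.{u} Aᵐᵒᵖ ⥤ E.EntwinedModule where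
  obj N := E.cofree (ScalarRestrict R N)
  map f := cofreeMap (scalarRestrictMap f)
  map_id _ := EntwinedModule.Hom.ext (LinearMap.ext fun x => cofreeLinearMap_id x)
  map_comp f g := EntwinedModule.Hom.ext (LinearMap.ext fun x =>
    cofreeLinearMap_comp_apply (scalarRestrictMap g) (scalarRestrictMap f) x)

/-- The identity from an entwined module to its underlying `A`-module. -/
def forgetEquiv (M : E.EntwinedModule) :
    M.carrier ≃ₗ[Aᵐᵒᵖ] ScalarRestrict R (E.forgetToModule.obj M) :=
  toScalarRestrict R (E.forgetToModule.obj M)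

theorem cofreeLinearMap_coactLinearMap {M N : E.EntwinedModule} (g : M ⟶ N) (m : M.carrier) :
    E.cofreeLinearMap g.toLinearMap (coactLinearMap M m) = coactLinearMap N (g.toLinearMap m) :=
  (g.colinear m).symm

variable (E) in
/-- The forgetful functor to `A`-modules is left adjoint to `- ⊗ C`. -/
def forgetAdjunction : E.forgetToModule ⊣ E.cofreeFunctor :=
  Adjunction.mkOfUnitCounit
    { unit :=
        { app := fun M => coactHom M ≫ cofreeMap (forgetEquiv M).toLinearMap
          naturality := fun M N f => EntwinedModule.Hom.ext (LinearMap.ext fun m => by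
            change E.cofreeLinearMap (forgetEquiv N).toLinearMap
                (coactLinearMap N (f.toLinearMap m)) =
              E.cofreeLinearMap (scalarRestrictMap (E.forgetToModule.map f))
                (E.cofreeLinearMap (forgetEquiv M).toLinearMap (coactLinearMap M m))
            rw [← cofreeLinearMap_coactLinearMap, ← cofreeLinearMap_comp_apply,
              ← cofreeLinearMap_comp_apply]
            rfl) }
      counit :=
        { app := fun N => ModuleCat.ofHom ((toScalarRestrict R N).symm.toLinearMap ∘ₗ
            E.counitLinearMap (ScalarRestrict R N))
          naturality := fun N P f => by
            ext x
            exact counitLinearMap_cofreeLinearMap (scalarRestrictMap f) x }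
      left_triangle := by
        ext M m
        change E.counitLinearMap _ (E.cofreeLinearMap (forgetEquiv M).toLinearMap
          (coactLinearMap M m)) = forgetEquiv M m
        rw [counitLinearMap_cofreeLinearMap]
        exact M.counit m
      right_triangle := by
        ext N : 2
        refine EntwinedModule.Hom.ext (LinearMap.ext fun x => ?_)
        refine Eq.trans (cofreeLinearMap_comp_apply
          (M := (E.cofree (ScalarRestrict R N)).carrier)
          (N := ScalarRestrict R (E.forgetToModule.obj (E.cofree (ScalarRestrict R N))))
          (scalarRestrictMap (P := N) (ModuleCat.ofHom ((toScalarRestrict R N).symm.toLinearMap ∘ₗ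
            E.counitLinearMap (ScalarRestrict R N))))
          (forgetEquiv (E.cofree (ScalarRestrict R N))).toLinearMap
          (coactLinearMap (E.cofree (ScalarRestrict R N)) x)).symm ?_
        exact cofreeLinearMap_counitLinearMap x }

instance : E.forgetToModule.Faithful where
  map_injective h := EntwinedModule.Hom.ext (congrArg ModuleCat.Hom.hom h)

/-- The given `R`-structure on `K` and the one restricted from `A` agree, but not by definition. The
identity `forgetEquiv` between them therefore appears in the formulas and has to be cancelled. -/
theorem cofreeLinearMap_forgetEquiv_injective (K : E.EntwinedModule) :
    Function.Injective (E.cofreeLinearMap (forgetEquiv K).toLinearMap) := by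
  refine Function.LeftInverse.injective
    (g := E.cofreeLinearMap (forgetEquiv K).symm.toLinearMap) fun x => ?_
  rw [← cofreeLinearMap_comp_apply, LinearEquiv.comp_coe, LinearEquiv.self_trans_symm]
  exact cofreeLinearMap_id x

/-- The commuting square of a coalgebra morphism is colinearity once `forgetEquiv` is cancelled. -/
instance : (Comonad.comparison E.forgetAdjunction).Full where
  map_surjective {M N} φ := by
    let f : E.forgetToModule.obj M ⟶ E.forgetToModule.obj N := φ.f
    let f' : M.carrier →ₗ[Aᵐᵒᵖ] N.carrier := f.hom
    refine ⟨⟨f', fun m => ?_⟩, rfl⟩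
    have h : E.cofreeLinearMap (scalarRestrictMap f)
        (E.cofreeLinearMap (forgetEquiv M).toLinearMap (coactLinearMap M m)) =
        E.cofreeLinearMap (forgetEquiv N).toLinearMap (coactLinearMap N (f' m)) :=
      LinearMap.congr_fun (congrArg ModuleCat.Hom.hom φ.h) m
    refine cofreeLinearMap_forgetEquiv_injective N (h.symm.trans ?_)
    refine (cofreeLinearMap_comp_apply (scalarRestrictMap f)
      (forgetEquiv M).toLinearMap _).symm.trans (Eq.trans ?_ (cofreeLinearMap_comp_apply (forgetEquiv N).toLinearMap f' _))
    rfl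

theorem cofreeLinearMap_forgetEquiv_comp (K : E.EntwinedModule) {M : Type u} [AddCommGroup M]
    [Module R M] [Module Aᵐᵒᵖ M] [IsScalarTower R Aᵐᵒᵖ M] (a : M →ₗ[Aᵐᵒᵖ] K.carrier)
    (x : E.Cofree M) : E.cofreeLinearMap ((forgetEquiv K).toLinearMap ∘ₗ a) x =
      E.cofreeLinearMap (forgetEquiv K).toLinearMap (E.cofreeLinearMap a x) :=
  cofreeLinearMap_comp_apply _ _ _

/-- The structure map of a coalgebra over the comonad `- ⊗ C`. -/
def coalgebraLinearMap (X : E.forgetAdjunction.toComonad.Coalgebra) :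
    ScalarRestrict R X.A →ₗ[Aᵐᵒᵖ] E.Cofree (ScalarRestrict R X.A) := X.a.hom

theorem cofreeCoact_coalgebraLinearMap (X : E.forgetAdjunction.toComonad.Coalgebra)
    (m : ScalarRestrict R X.A) :
    E.cofreeCoact _ (coalgebraLinearMap X m) =
      ((coalgebraLinearMap X).restrictScalars R).rTensor C
        ((E.toCofree _).symm (coalgebraLinearMap X m)) := by
  let N := ScalarRestrict R X.A
  have h : E.cofreeLinearMap (forgetEquiv (E.cofree N)).toLinearMap
        (coactLinearMap (E.cofree N) (coalgebraLinearMap X m)) =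
      E.cofreeLinearMap (N := ScalarRestrict R (E.forgetToModule.obj (E.cofree N)))
        (scalarRestrictMap X.a) (coalgebraLinearMap X m) :=
    LinearMap.congr_fun (congrArg ModuleCat.Hom.hom X.coassoc) m
  have h' := cofreeLinearMap_forgetEquiv_comp (E.cofree N) (coalgebraLinearMap X)
    (coalgebraLinearMap X m)
  exact cofreeLinearMap_forgetEquiv_injective (E.cofree N) (h.trans h')

/-- An entwined module from a coalgebra over the comonad `- ⊗ C`. -/
def ofCoalgebra (X : E.forgetAdjunction.toComonad.Coalgebra) : E.EntwinedModule where
  carrier := ScalarRestrict R X.A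
  coact := (E.toCofree (ScalarRestrict R X.A)).symm.toLinearMap ∘ₗ
    (coalgebraLinearMap X).restrictScalars R
  coassoc m := by
    have h := cofreeCoact_coalgebraLinearMap X m
    rw [← (E.toCofree (ScalarRestrict R X.A)).apply_symm_apply (coalgebraLinearMap X m),
      cofreeCoact_toCofree, LinearEquiv.symm_apply_apply] at h
    rw [← LinearEquiv.eq_symm_apply, LinearMap.rTensor_comp_apply]
    refine (congrArg _ h.symm).trans ?_
    rw [← LinearMap.rTensor_comp_apply, LinearEquiv.comp_coe, LinearEquiv.self_trans_symm]
    exact LinearMap.rTensor_id_apply _ _ _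
  counit m := LinearMap.congr_fun (congrArg ModuleCat.Hom.hom X.counit) m
  compat m a := LinearMap.map_smul X.a.hom (op a) m

instance : (Comonad.comparison E.forgetAdjunction).EssSurj where
  mem_essImage X := ⟨ofCoalgebra X, ⟨Comonad.Coalgebra.isoMk
    ((toScalarRestrict R X.A).symm.toModuleIso) (by
      ext m
      let M := ofCoalgebra X
      refine (cofreeLinearMap_comp_apply (E := E) (M := M.carrier)
        (N := ScalarRestrict R (E.forgetToModule.obj M)) (P := ScalarRestrict R X.A)
        (scalarRestrictMap (N := E.forgetToModule.obj M) (P := X.A)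
          ((toScalarRestrict R X.A).symm.toModuleIso.hom)) (forgetEquiv M).toLinearMap
          (coactLinearMap M m)).symm.trans ?_
      exact cofreeLinearMap_id _)⟩⟩

instance : (Comonad.comparison E.forgetAdjunction).IsEquivalence where

instance : ComonadicLeftAdjoint E.forgetToModule where
  R := E.cofreeFunctor
  adj := E.forgetAdjunction
  eqv := inferInstance

end EntwiningStructure

/-! ### Transfer of abelianness. -/

namespace CategoryTheory

open Limits

variable {𝒞 : Type v} {𝒟 : Type w} [Category.{v'} 𝒞] [Category.{w'} 𝒟]

/-- A preadditive category with finite limits and colimits is abelian if it has an exact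
conservative functor to an abelian category. -/
@[reducible] def abelianOfExactConservative [Preadditive 𝒞] [Abelian 𝒟] [HasFiniteLimits 𝒞]
    [HasFiniteColimits 𝒞] (F : 𝒞 ⥤ 𝒟) [F.PreservesZeroMorphisms] [PreservesFiniteLimits F]
    [PreservesFiniteColimits F] [F.ReflectsIsomorphisms] : Abelian 𝒞 := by
  have : HasFiniteProducts 𝒞 := inferInstance
  -- Exactness identifies the image under `F` of this comparison with the comparison for `F.map f`,
  -- an isomorphism in an abelian category; conservativity brings this back.
  have (X Y : 𝒞) (f : X ⟶ Y) : IsIso (Abelian.coimageImageComparison f) := by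
    have : IsIso (F.map (Abelian.coimageImageComparison f)) :=
      (Arrow.isIso_iff_isIso_of_isIso
        (Abelian.PreservesCoimageImageComparison.iso F f).hom).2 inferInstance
    exact isIso_of_reflects_iso _ F
  exact Abelian.ofCoimageImageComparisonIsIso

end CategoryTheory

/-! ### Limits, colimits and exactness for flat `C`. -/

namespace EntwiningStructure

open Limits

variable {R A C : Type u} [CommRing R] [Ring A] [Algebra R A]
  [AddCommGroup C] [Module R C] [Coalgebra R C] {E : EntwiningStructure R A C}

instance : (E.cofreeFunctor ⋙ E.forgetToModule).Additive where
  map_add {N P f g} := by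
    ext x
    exact LinearMap.congr_fun
      (cofreeLinearMap_add (scalarRestrictMap f) (scalarRestrictMap g)) x

instance [Module.Flat R C] : PreservesFiniteLimits (E.cofreeFunctor ⋙ E.forgetToModule) := by
  refine (((E.cofreeFunctor ⋙ E.forgetToModule).exact_tfae.out 1 3 :).1 fun S hS => ?_).1
  rw [ShortComplex.ShortExact.moduleCat_exact_iff_function_exact] at hS ⊢
  have h : Function.Exact ((scalarRestrictMap (R := R) S.f).restrictScalars R)
    ((scalarRestrictMap (R := R) S.g).restrictScalars R) := hS
  exact Module.Flat.rTensor_exact C h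

instance [Module.Flat R C] :
    PreservesFiniteLimits (comonadicRightAdjoint E.forgetToModule ⋙ E.forgetToModule) :=
  inferInstanceAs (PreservesFiniteLimits (E.cofreeFunctor ⋙ E.forgetToModule))

instance : E.forgetAdjunction.toComonad.toFunctor.Additive :=
  inferInstanceAs ((E.cofreeFunctor ⋙ E.forgetToModule).Additive)

/-- The sum of morphisms is transported from coalgebras over the additive comonad `- ⊗ C`. -/
instance : Preadditive E.EntwinedModule :=
  Preadditive.ofFullyFaithful
    (Functor.FullyFaithful.ofFullyFaithful (Comonad.comparison E.forgetAdjunction))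

instance : E.forgetToModule.Additive where
  map_add {_ _ f g} := congrArg Comonad.Coalgebra.Hom.f
    ((Functor.FullyFaithful.ofFullyFaithful (Comonad.comparison E.forgetAdjunction)).map_preimage
      ((Comonad.comparison E.forgetAdjunction).map f +
        (Comonad.comparison E.forgetAdjunction).map g))

instance : E.forgetToModule.ReflectsIsomorphisms :=
  inferInstanceAs ((Comonad.comparison E.forgetAdjunction ⋙
    E.forgetAdjunction.toComonad.forget).ReflectsIsomorphisms)

instance : HasColimitsOfSize.{u, u} E.EntwinedModule :=
  have := comonadicCreatesColimits.{u, u} E.forgetToModule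
  hasColimits_of_hasColimits_createsColimits E.forgetToModule

instance : PreservesColimitsOfSize.{u, u} E.forgetToModule :=
  E.forgetAdjunction.leftAdjoint_preservesColimits

/-- A comonadic functor creates the limits that its comonad preserves; flatness supplies the finite
ones. -/
instance (J : Type) [SmallCategory J] [FinCategory J] [Module.Flat R C] :
    CreatesLimitsOfShape J E.forgetToModule where
  CreatesLimit {K} := comonadicCreatesLimitOfPreservesLimit _ K

instance [Module.Flat R C] : HasFiniteLimits E.EntwinedModule where
  out _ _ _ := hasLimitsOfShape_of_hasLimitsOfShape_createsLimitsOfShape E.forgetToModule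

instance [Module.Flat R C] : PreservesFiniteLimits E.forgetToModule where
  preservesFiniteLimits _ _ _ := inferInstance

instance [Module.Flat R C] : Abelian E.EntwinedModule :=
  abelianOfExactConservative E.forgetToModule

instance [Module.Flat R C] : ReflectsFiniteLimits E.forgetToModule where
  reflects _ _ _ := reflectsLimitsOfShape_of_reflectsIsomorphisms

/-- Filtered colimits are exact because the forgetful functor preserves colimits and both preserves
and reflects finite limits. -/
theorem isGrothendieckAbelian_of_hasSeparator [Module.Flat R C] [HasSeparator E.EntwinedModule] :
    IsGrothendieckAbelian.{u} E.EntwinedModule where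
  ab5OfSize :=
    { ofShape J _ _ := HasExactColimitsOfShape.domain_of_functor J E.forgetToModule }

end EntwiningStructure

/-! ### A small separating family of countably generated entwined modules. -/

namespace EntwiningStructure

open Limits

variable {R A C : Type u} [CommRing R] [Ring A] [Algebra R A]
  [AddCommGroup C] [Module R C] [Coalgebra R C] {E : EntwiningStructure R A C}

section Induced

variable [Module.Flat R C] (M : E.EntwinedModule) {Q : Type u} [AddCommGroup Q] [Module R Q]
  [Module Aᵐᵒᵖ Q] [IsScalarTower R Aᵐᵒᵖ Q] (ι : Q →ₗ[Aᵐᵒᵖ] M.carrier)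
  (hι : Function.Injective ι)
  (h : ∀ q, M.coact (ι q) ∈ LinearMap.range ((ι.restrictScalars R).rTensor C))

theorem rTensor_injective_of_injective (hι : Function.Injective ι) :
    Function.Injective ((ι.restrictScalars R).rTensor C) :=
  Module.Flat.rTensor_preserves_injective_linearMap (ι.restrictScalars R) hι

/-- The coaction of a subobject. -/
def inducedCoact : Q →ₗ[R] Q ⊗[R] C :=
  (LinearEquiv.ofInjective _ (rTensor_injective_of_injective M ι hι)).symm.toLinearMap ∘ₗ
    (M.coact ∘ₗ ι.restrictScalars R).codRestrict _ h

theorem rTensor_inducedCoact (q : Q) :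
    (ι.restrictScalars R).rTensor C (inducedCoact M ι hι h q) = M.coact (ι q) :=
  congrArg Subtype.val ((LinearEquiv.ofInjective _
    (rTensor_injective_of_injective M ι hι)).apply_symm_apply ⟨M.coact (ι q), h q⟩)

/-- Flatness, used twice, embeds `(Q ⊗ C) ⊗ C` into `(M ⊗ C) ⊗ C`, where the identity is
coassociativity of `M`. -/
theorem inducedCoact_coassoc (q : Q) :
    TensorProduct.assoc R Q C C
      ((inducedCoact M ι hι h).rTensor C (inducedCoact M ι hι h q)) =
      (Coalgebra.comul (R := R) (A := C)).lTensor Q (inducedCoact M ι hι h q) := by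
  rw [← LinearEquiv.eq_symm_apply]
  refine Module.Flat.rTensor_preserves_injective_linearMap (M := C) _
    (rTensor_injective_of_injective M ι hι) ?_
  have h1 : (ι.restrictScalars R).rTensor C ∘ₗ inducedCoact M ι hι h =
      M.coact ∘ₗ ι.restrictScalars R := LinearMap.ext (rTensor_inducedCoact M ι hι h)
  have h2 (x : Q ⊗[R] C) : ((ι.restrictScalars R).rTensor C).rTensor C
      ((TensorProduct.assoc R Q C C).symm
        ((Coalgebra.comul (R := R) (A := C)).lTensor Q x)) =
      (TensorProduct.assoc R M.carrier C C).symm ((Coalgebra.comul (R := R) (A := C)).lTensor _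
        ((ι.restrictScalars R).rTensor C x)) := by
    induction x with
    | zero => simp
    | add y z hy hz => simp only [map_add, hy, hz]
    | tmul q c =>
      simp only [LinearMap.lTensor_tmul, LinearMap.rTensor_tmul]
      induction Coalgebra.comul (R := R) c with
      | zero => simp
      | add y z hy hz => simp only [TensorProduct.tmul_add, map_add, hy, hz]
      | tmul a b => simp
  rw [h2, rTensor_inducedCoact, ← LinearMap.rTensor_comp_apply, h1, LinearMap.rTensor_comp_apply,
    rTensor_inducedCoact, ← M.coassoc, LinearEquiv.symm_apply_apply]

theorem inducedCoact_counit (q : Q) :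
    TensorProduct.rid R Q ((Coalgebra.counit (R := R) (A := C)).lTensor Q
      (inducedCoact M ι hι h q)) = q := by
  refine hι ((contract_rTensor (Coalgebra.counit (R := R) (A := C))
    (ι.restrictScalars R) (inducedCoact M ι hι h q)).symm.trans ?_)
  rw [rTensor_inducedCoact]
  exact M.counit (ι q)

theorem inducedCoact_compat (q : Q) (a : A) :
    inducedCoact M ι hι h (op a • q) = E.twist Q (inducedCoact M ι hι h q ⊗ₜ a) := by
  refine rTensor_injective_of_injective M ι hι ?_
  have h1 : (ι.restrictScalars R).rTensor C (E.twist Q (inducedCoact M ι hι h q ⊗ₜ a)) =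
      E.twist M.carrier ((ι.restrictScalars R).rTensor C (inducedCoact M ι hι h q) ⊗ₜ a) :=
    (E.cofreeLinearMap ι).map_smul (op a) (E.toCofree Q (inducedCoact M ι hι h q))
  rw [h1, rTensor_inducedCoact, rTensor_inducedCoact, map_smul, M.compat]

end Induced

variable (E) in
/-- An entwined structure on a countably generated right `A`-module, presented as a quotient of
the free module on `ℕ`. -/
structure CountablyGenerated where
  /-- the relations -/
  ker : Submodule Aᵐᵒᵖ (ℕ →₀ Aᵐᵒᵖ)
  /-- the coaction -/
  coact : ((ℕ →₀ Aᵐᵒᵖ) ⧸ ker) →ₗ[R] ((ℕ →₀ Aᵐᵒᵖ) ⧸ ker) ⊗[R] C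
  coassoc : ∀ m, TensorProduct.assoc R _ C C (coact.rTensor C (coact m)) =
    (Coalgebra.comul (R := R) (A := C)).lTensor _ (coact m)
  counit : ∀ m, TensorProduct.rid R _
    ((Coalgebra.counit (R := R) (A := C)).lTensor _ (coact m)) = m
  compat : ∀ m (a : A), coact (op a • m) = E.twist _ (coact m ⊗ₜ a)

/-- The entwined module of a countably generated entwined structure. -/
def CountablyGenerated.toEntwinedModule (X : E.CountablyGenerated) : E.EntwinedModule where
  carrier := (ℕ →₀ Aᵐᵒᵖ) ⧸ X.ker
  coact := X.coact
  coassoc := X.coassoc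
  counit := X.counit
  compat := X.compat

/-- Each element of an entwined module lies in a countable set whose coactions only involve
elements of this set. -/
theorem exists_seq_coact (M : E.EntwinedModule) (m : M.carrier) :
    ∃ s : ℕ → M.carrier, m ∈ Set.range s ∧ ∀ n, ∃ T : Finset (M.carrier × C),
      M.coact (s n) = ∑ i ∈ T, i.1 ⊗ₜ[R] i.2 ∧ ∀ i ∈ T, i.1 ∈ Set.range s := by
  classical
  choose T hT using fun x : M.carrier => TensorProduct.exists_finset (M.coact x)
  -- Stage `n + 1` collects the left factors of the chosen expressions for the coactions of stage
  -- `n`. The union of these finite stages is countable and closed.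
  let S : ℕ → Finset M.carrier := fun n =>
    Nat.rec {m} (fun _ F => F.biUnion fun x => (T x).image Prod.fst) n
  have hm : m ∈ ⋃ n, {x | x ∈ S n} := Set.mem_iUnion.2 ⟨0, Finset.mem_singleton_self m⟩
  obtain ⟨s, hs⟩ := (Set.countable_iUnion fun n => (S n).countable_toSet).exists_eq_range ⟨m, hm⟩
  refine ⟨s, hs ▸ hm, fun n => ⟨T (s n), hT _, fun i hi => ?_⟩⟩
  have hn : s n ∈ ⋃ n, {x | x ∈ S n} := hs ▸ Set.mem_range_self n
  obtain ⟨k, hk⟩ := Set.mem_iUnion.1 hn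
  rw [← hs]
  exact Set.mem_iUnion.2 ⟨k + 1,
    Finset.mem_biUnion.2 ⟨s n, hk, Finset.mem_image_of_mem _ hi⟩⟩

/-- The `A`-span of the closed countable set through `m` is a subcomodule. It is taken as a quotient
of the free module on `ℕ`, so that all modules arising this way form a small family. -/
theorem exists_countablyGenerated_hom [Module.Flat R C] (M : E.EntwinedModule) (m : M.carrier) :
    ∃ (X : E.CountablyGenerated) (g : X.toEntwinedModule ⟶ M) (x : X.toEntwinedModule.carrier),
      g.toLinearMap x = m := by
  obtain ⟨s, ⟨k, hk⟩, hs⟩ := exists_seq_coact M m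
  let π : (ℕ →₀ Aᵐᵒᵖ) →ₗ[Aᵐᵒᵖ] M.carrier := Finsupp.linearCombination Aᵐᵒᵖ s
  let ι : ((ℕ →₀ Aᵐᵒᵖ) ⧸ LinearMap.ker π) →ₗ[Aᵐᵒᵖ] M.carrier :=
    (LinearMap.ker π).liftQ π le_rfl
  have hι : Function.Injective ι := LinearMap.ker_eq_bot.1 (Submodule.ker_liftQ_eq_bot' _ _ rfl)
  have hsι (n : ℕ) : ι ((LinearMap.ker π).mkQ (Finsupp.single n 1)) = s n := by
    simp [ι, π]
  -- The coaction is `A`-linear for the twisted action, so the elements whose coaction comes from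
  -- the span form an `A`-submodule, and checking the generators suffices.
  have hle : LinearMap.range π ≤
      (LinearMap.range (E.cofreeLinearMap ι)).comap (coactLinearMap M) := by
    rw [Finsupp.range_linearCombination, Submodule.span_le]
    rintro _ ⟨n, rfl⟩
    obtain ⟨T, hT, hT'⟩ := hs n
    change E.toCofree _ (M.coact (s n)) ∈ LinearMap.range (E.cofreeLinearMap ι)
    rw [hT, map_sum]
    refine Submodule.sum_mem _ fun i hi => ?_
    obtain ⟨l, hl⟩ := hT' i hi
    refine ⟨E.toCofree _ ((LinearMap.ker π).mkQ (Finsupp.single l 1) ⊗ₜ i.2), ?_⟩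
    rw [cofreeLinearMap_toCofree, LinearMap.rTensor_tmul, LinearMap.restrictScalars_apply, hsι, hl]
  have h (q) : M.coact (ι q) ∈ LinearMap.range ((ι.restrictScalars R).rTensor C) := by
    obtain ⟨z, rfl⟩ := (LinearMap.ker π).mkQ_surjective q
    obtain ⟨y, hy⟩ := hle ⟨z, rfl⟩
    exact ⟨y, hy⟩
  refine ⟨⟨LinearMap.ker π, inducedCoact M ι hι h, inducedCoact_coassoc M ι hι h,
    inducedCoact_counit M ι hι h, inducedCoact_compat M ι hι h⟩,
    ⟨ι, fun q => (rTensor_inducedCoact M ι hι h q).symm⟩,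
    (LinearMap.ker π).mkQ (Finsupp.single k 1), (hsι k).trans hk⟩

/-- Every element of `M` is in the image of some member of the family, so a morphism out of `M` is
determined by its composites with maps from the family. -/
instance [Module.Flat R C] : HasSeparator E.EntwinedModule where
  hasSeparator := by
    refine ⟨∐ fun X : E.CountablyGenerated => X.toEntwinedModule, (isSeparator_sigma _).2 ?_⟩
    intro M N f g hfg
    refine EntwinedModule.Hom.ext (LinearMap.ext fun m => ?_)
    obtain ⟨X, φ, x, rfl⟩ := exists_countablyGenerated_hom M m
    exact LinearMap.congr_fun
      (congrArg EntwinedModule.Hom.toLinearMap (hfg _ (ObjectProperty.ofObj_apply _ X) φ)) x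

end EntwiningStructure

end

theorem mainTheorem7 {R A C : Type u} [CommRing R] [Ring A] [Algebra R A]
    [AddCommGroup C] [Module R C] [Coalgebra R C] (E : EntwiningStructure R A C) :
    (Module.Flat R C →
      ∃ _ : Abelian E.EntwinedModule,
        IsGrothendieckAbelian.{u} E.EntwinedModule ∧ EnoughInjectives E.EntwinedModule) ∧
    (IsLocallyProjective R C →
      E.AlphaCondition ∧
      (∃ h : ∀ M, E.IsRational (E.toSharpModule.obj M),
        IsIsomorphismOfCategories (E.IsRational.lift E.toSharpModule h)) ∧
      (∃ h : ∀ M, IsSubgenerated E.coringModule (E.toSharpModule.obj M),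
        IsIsomorphismOfCategories ((IsSubgenerated E.coringModule).lift E.toSharpModule h)) ∧
      E.IsRational = IsSubgenerated E.coringModule) ∧
    (Module.Finite R C → Module.Projective R C →
      IsIsomorphismOfCategories E.toSharpModule) := by
  refine ⟨fun _ => ⟨inferInstance, EntwiningStructure.isGrothendieckAbelian_of_hasSeparator,
    ?_⟩, fun h => ?_, fun _ _ => EntwiningStructure.isIsomorphismOfCategories_toSharpModule⟩
  · have := EntwiningStructure.isGrothendieckAbelian_of_hasSeparator (E := E)
    exact IsGrothendieckAbelian.enoughInjectives.{u}
  · exact ⟨E.alphaCondition_of_isLocallyProjective h,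
      ⟨EntwiningStructure.isRational_toSharpModule_obj,
        EntwiningStructure.isIsomorphismOfCategories_lift h _ rfl _⟩,
      ⟨EntwiningStructure.isSubgenerated_toSharpModule_obj,
        EntwiningStructure.isIsomorphismOfCategories_lift h _
          (EntwiningStructure.isRational_eq_isSubgenerated h) _⟩,
      EntwiningStructure.isRational_eq_isSubgenerated h⟩
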